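/- **Fermionic triangularization of $H_t$.** Let $\psi_r,\psi^*_r$ ($r\in\mathbb Z+\tfrac12$) be the fermion modes with $\{\psi_r,\psi^*_s\}=\delta_{r+s,0}$, $\{\psi_r,\psi_s\}=\{\psi^*_r,\psi^*_s\}=0$, acting on the Fock space over $\mathbb C$ generated from a vacuum with $\psi_r|vac\rangle=\psi^*_r|vac\rangle=0$ for $r>0$; let $:\ :$ denote normal ordering (modes of negative index to the left of modes of positive index, with the sign of the permutation). For a Young diagram $\lambda$ with transpose $\lambda^t$ and diagonal length $d$, put $n_i=\lambda_i-i+\tfrac12$ (row modes), $m_i=\lambda^t_i-i+\tfrac12$ (column modes), $1\le i\le d$, and let $$|s_\lambda\rangle=(-1)^{\sum_{i=1}^d (m_i-\frac12)}\prod_{i=1}^{d}\psi_{-n_i}\psi^*_{-m_i}|vac\rangle$$ be the Schur state. Let $$H_t=\sum_{\substack{s,k,l\in\mathbb Z+\frac12\\ k+l>0,\ k+s\ne0}}\Big(2k+\tfrac23(s+l)\Big):\psi_{-s-k-l}\psi^*_s\psi_k\psi^*_l:\,.$$ All the sums here and below are locally finite (all but finitely many terms kill a given vector). In them $k,r,s,l$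 run over half-integers and $n$ over integers. Then, as operators on the Fock space, $$H_t=2\sum_{\substack{k+l>0,\ k+s<0\\ k>r,\ r+s+k+l=0}}(k-r):\psi_r\psi^*_s\psi_k\psi^*_l:$$ $$=2\sum_{\substack{k>r>0\\ 1\le n\le r-1/2}}(r-k)\,\psi^*_{-k-n}\psi^*_{-r+n}\psi_r\psi_k+2\sum_{\substack{k>r>0\\ 1\le n\le[(k-r-1)/2]}}(r-k+2n)\,\psi_{-k+n}\psi_{-r-n}\psi^*_r\psi^*_k$$ $$+2\sum_{\substack{k,r>0\\ 1\le n\le r-1/2}}(k+r-n)\,\psi_{-r+n}\psi^*_{-k-n}\psi_k\psi^*_r+2\sum_{\substack{k>r>0\\ s>0}}(r-k)\,\psi^*_{-r-s-k}\psi_r\psi_k\psi^*_s+2\sum_{\substack{k>r>0\\ s>0}}(k-r)\,\psi_{-k}\psi^*_{-s}\psi_{-r}\psi^*_{r+s+k}\,.$$ Each monomial in the last five sums sends each Schur state $|s_\lambda\rangle$ either to $0$ or to $\pm|s_\mu\rangle$, where $\mu$ is strictly below $\lambda$ in dominance order ($|\mu|=|\lambda|$, $\mu\neq\lambda$, $\sum_{i\le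 j}\mu_i\le\sum_{i\le j}\lambda_i$ for all $j$) and arises from $\lambda$ as follows, in the five families respectively: (I) the column modes $r,k$ are replaced by the column modes $k+n,\ r-n$; (II) the row modes $r,k$ are replaced by the row modes $k-n,\ r+n$; (III) the row mode $r$ and the column mode $k$ are replaced by the row mode $r-n$ and the column mode $k+n$; (IV) the column modes $r,k$ and the row mode $s$ are replaced by the single column mode $r+k+s$; (V) the row mode $r+k+s$ is replaced by the row modes $k,r$ and the column mode $s$. Consequently, for every $\lambda$, $H_t|s_\lambda\rangle$ is a linear combination of Schur states $|s_\mu\rangle$ with $\mu$ strictly below $\lambda$ in dominance order. -/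

import Mathlib

namespace CSFermion

noncomputable section

/-! ### The fermionic Fock space and the modes `ψ_r`, `ψ*_r` -/

/-- The half-integers `ℤ + 1/2`. -/
def HalfInt : Set ℚ := {r | ∃ n : ℤ, r = n + 1 / 2}

/-- The span of the creation modes: `Sum.inl n` is `ψ_{-(n+1/2)}`,
`Sum.inr n` is `ψ*_{-(n+1/2)}`, for `n = 0, 1, 2, …`. -/
abbrev Modes : Type := (ℕ ⊕ ℕ) →₀ ℂ

/-- The fermionic Fock space: the exterior algebra on the creation modes, with vacuum `1`. -/
abbrev Fock : Type := ExteriorAlgebra ℂ Modes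

/-- The vacuum `|vac⟩`. -/
def vac : Fock := 1

/-- The creation operator of a mode: exterior multiplication from the left. -/
def create (i : ℕ ⊕ ℕ) : Module.End ℂ Fock :=
  LinearMap.mulLeft ℂ (ExteriorAlgebra.ι ℂ (Finsupp.single i (1 : ℂ)))

/-- The annihilation operator of a mode: contraction with the dual coordinate form. -/
def annihilate (i : ℕ ⊕ ℕ) : Module.End ℂ Fock :=
  CliffordAlgebra.contractLeft (Q := (0 : QuadraticForm ℂ Modes))
    (Finsupp.lapply (R := ℂ) (M := ℂ) i)

/-- The mode `ψ_r`, for `r ∈ ℤ + 1/2` (it is only used for such `r`). If `r < 0` it is a creation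
operator; if `r > 0` it annihilates the mode created by `ψ*_{-r}`. -/
def psi (r : ℚ) : Module.End ℂ Fock :=
  if 0 < r then annihilate (Sum.inr ⌊|r|⌋₊) else create (Sum.inl ⌊|r|⌋₊)

/-- The mode `ψ*_r`, for `r ∈ ℤ + 1/2` (it is only used for such `r`). If `r < 0` it is a creation
operator; if `r > 0` it annihilates the mode created by `ψ_{-r}`. -/
def psiStar (r : ℚ) : Module.End ℂ Fock :=
  if 0 < r then annihilate (Sum.inl ⌊|r|⌋₊) else create (Sum.inr ⌊|r|⌋₊)

/-- A letter of a fermionic word: `psi r` stands for `ψ_r` and `psiStar r` for `ψ*_r`. -/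
inductive Letter : Type
  | psi (r : ℚ) : Letter
  | psiStar (r : ℚ) : Letter

/-- The index of a letter. -/
def Letter.index : Letter → ℚ
  | .psi r => r
  | .psiStar r => r

/-- The operator that a letter stands for. -/
def Letter.op : Letter → Module.End ℂ Fock
  | .psi r => CSFermion.psi r
  | .psiStar r => CSFermion.psiStar r

/-- Normal ordering `:w:` of a word: creation operators (negative index) are moved to the left of
annihilation operators (positive index), with the sign of the permutation. A leading
annihilation operator is moved to the right end past all the other letters. -/
def normalOrder : List Letter → Module.End ℂ Fock
  | [] => 1
  | a :: w =>
    if 0 < a.index then ((-1 : ℂ) ^ w.length) • (normalOrder w * a.op)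
    else a.op * normalOrder w

/-- `:ψ_r ψ*_s ψ_k ψ*_l:` -/
def normalQuartic (r s k l : ℚ) : Module.End ℂ Fock :=
  normalOrder [Letter.psi r, Letter.psiStar s, Letter.psi k, Letter.psiStar l]

/-! ### Infinite sums of operators -/

/-- A family of operators is locally finite on an index set if every vector is killed by all
but finitely many members. -/
def LocFinite {ι : Type} (S : Set ι) (T : ι → Module.End ℂ Fock) : Prop :=
  ∀ v : Fock, {i | i ∈ S ∧ T i v ≠ 0}.Finite

open Classical in
/-- The sum `∑_{i ∈ S} T i` of a locally finite family of operators, taken on each vector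
(and `0` if the family is not locally finite). -/
def opSum {ι : Type} (S : Set ι) (T : ι → Module.End ℂ Fock) : Module.End ℂ Fock :=
  if h : LocFinite S T then
    { toFun := fun v => ∑ᶠ i : S, T i v
      map_add' := fun v w => by
        have key : ∀ u : Fock, (Function.support fun i : S => T i u).Finite := fun u => by
          refine Set.Finite.of_finite_image (f := Subtype.val) ((h u).subset ?_)
            Subtype.val_injective.injOn
          rintro _ ⟨i, hi, rfl⟩
          exact ⟨i.2, hi⟩
        simp only [map_add]
        exact finsum_add_distrib (key v) (key w)
      map_smul' := fun c v => by
        simp only [map_smul, RingHom.id_apply]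
        exact (smul_finsum c _).symm }
  else 0

/-! ### The operator `H_t` -/

/-- An index quadruple `(r, s, k, l)`. -/
structure Quad : Type where
  r : ℚ
  s : ℚ
  k : ℚ
  l : ℚ

/-- An index triple `(s, k, l)`. -/
structure Triple : Type where
  s : ℚ
  k : ℚ
  l : ℚ

/-- Summation range of `H_t`: half-integers `s, k, l` with `k + l > 0`, without the diagonal terms
`k + s = 0` (those make up the diagonal operator `H_d`). -/
def HtRange : Set Triple :=
  {t | t.s ∈ HalfInt ∧ t.k ∈ HalfInt ∧ t.l ∈ HalfInt ∧ 0 < t.k + t.l ∧ t.k + t.s ≠ 0}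

/-- The terms `(2k + (2/3)(s + l)) :ψ_{-s-k-l} ψ*_s ψ_k ψ*_l:` of `H_t`. -/
def HtTerm (t : Triple) : Module.End ℂ Fock :=
  ((2 * t.k + 2 / 3 * (t.s + t.l) : ℚ) : ℂ) • normalQuartic (-t.s - t.k - t.l) t.s t.k t.l

/-- The interaction operator `H_t`. -/
def Ht : Module.End ℂ Fock := opSum HtRange HtTerm

/-- The reduced region: half-integers with `k + l > 0`, `k + s < 0`, `k > r`, `r + s + k + l = 0`. -/
def redRange : Set Quad :=
  {q | q.r ∈ HalfInt ∧ q.s ∈ HalfInt ∧ q.k ∈ HalfInt ∧ q.l ∈ HalfInt ∧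
    0 < q.k + q.l ∧ q.k + q.s < 0 ∧ q.r < q.k ∧ q.r + q.s + q.k + q.l = 0}

/-- The terms `(k - r) :ψ_r ψ*_s ψ_k ψ*_l:`. -/
def redTerm (q : Quad) : Module.End ℂ Fock :=
  ((q.k - q.r : ℚ) : ℂ) • normalQuartic q.r q.s q.k q.l

/-! ### The five families of processes -/

/-- Parameters `(k, r, n)` of the families I, II, III. -/
structure ParamN : Type where
  k : ℚ
  r : ℚ
  n : ℕ

/-- Parameters `(k, r, s)` of the families IV, V. -/
structure ParamS : Type where
  k : ℚ
  r : ℚ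
  s : ℚ

/-- `k > r > 0` and `1 ≤ n ≤ r - 1/2`. -/
def rangeI : Set ParamN :=
  {p | p.k ∈ HalfInt ∧ p.r ∈ HalfInt ∧ 0 < p.r ∧ p.r < p.k ∧ 1 ≤ p.n ∧ (p.n : ℚ) ≤ p.r - 1 / 2}

/-- `ψ*_{-k-n} ψ*_{-r+n} ψ_r ψ_k` -/
def procI (p : ParamN) : Module.End ℂ Fock :=
  psiStar (-p.k - p.n) * psiStar (-p.r + p.n) * psi p.r * psi p.k

/-- `k > r > 0` and `1 ≤ n ≤ [(k - r - 1)/2]`. -/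
def rangeII : Set ParamN :=
  {p | p.k ∈ HalfInt ∧ p.r ∈ HalfInt ∧ 0 < p.r ∧ p.r < p.k ∧
    1 ≤ p.n ∧ (p.n : ℤ) ≤ ⌊(p.k - p.r - 1) / 2⌋}

/-- `ψ_{-k+n} ψ_{-r-n} ψ*_r ψ*_k` -/
def procII (p : ParamN) : Module.End ℂ Fock :=
  psi (-p.k + p.n) * psi (-p.r - p.n) * psiStar p.r * psiStar p.k

/-- `k, r > 0` and `1 ≤ n ≤ r - 1/2`. -/
def rangeIII : Set ParamN :=
  {p | p.k ∈ HalfInt ∧ p.r ∈ HalfInt ∧ 0 < p.k ∧ 0 < p.r ∧ 1 ≤ p.n ∧ (p.n : ℚ) ≤ p.r - 1 / 2}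

/-- `ψ_{-r+n} ψ*_{-k-n} ψ_k ψ*_r` -/
def procIII (p : ParamN) : Module.End ℂ Fock :=
  psi (-p.r + p.n) * psiStar (-p.k - p.n) * psi p.k * psiStar p.r

/-- `k > r > 0` and `s > 0`. -/
def rangeIV : Set ParamS :=
  {p | p.k ∈ HalfInt ∧ p.r ∈ HalfInt ∧ p.s ∈ HalfInt ∧ 0 < p.r ∧ p.r < p.k ∧ 0 < p.s}

/-- `ψ*_{-r-s-k} ψ_r ψ_k ψ*_s` -/
def procIV (p : ParamS) : Module.End ℂ Fock :=
  psiStar (-p.r - p.s - p.k) * psi p.r * psi p.k * psiStar p.s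

/-- `k > r > 0` and `s > 0`. -/
def rangeV : Set ParamS :=
  {p | p.k ∈ HalfInt ∧ p.r ∈ HalfInt ∧ p.s ∈ HalfInt ∧ 0 < p.r ∧ p.r < p.k ∧ 0 < p.s}

/-- `ψ_{-k} ψ*_{-s} ψ_{-r} ψ*_{r+s+k}` -/
def procV (p : ParamS) : Module.End ℂ Fock :=
  psi (-p.k) * psiStar (-p.s) * psi (-p.r) * psiStar (p.r + p.s + p.k)

/-- The coefficient `r - k` times process I. -/
def termI (p : ParamN) : Module.End ℂ Fock := ((p.r - p.k : ℚ) : ℂ) • procI p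

/-- The coefficient `r - k + 2n` times process II. -/
def termII (p : ParamN) : Module.End ℂ Fock := ((p.r - p.k + 2 * p.n : ℚ) : ℂ) • procII p

/-- The coefficient `k + r - n` times process III. -/
def termIII (p : ParamN) : Module.End ℂ Fock := ((p.k + p.r - p.n : ℚ) : ℂ) • procIII p

/-- The coefficient `r - k` times process IV. -/
def termIV (p : ParamS) : Module.End ℂ Fock := ((p.r - p.k : ℚ) : ℂ) • procIV p

/-- The coefficient `k - r` times process V. -/
def termV (p : ParamS) : Module.End ℂ Fock := ((p.k - p.r : ℚ) : ℂ) • procV p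

/-! ### Schur states and dominance order -/

/-- The length `d(λ)` of the main diagonal. -/
def diagLen (lam : YoungDiagram) : ℕ := (lam.cells.filter fun c => c.1 = c.2).card

/-- `λ_i - i + 1/2` (for `i = 1, 2, …`), at the zero-based row `i`. -/
def rowMode (lam : YoungDiagram) (i : ℕ) : ℚ := (lam.rowLen i : ℚ) - i - 1 / 2

/-- `λᵗ_i - i + 1/2` (for `i = 1, 2, …`), at the zero-based column `i`. -/
def colMode (lam : YoungDiagram) (i : ℕ) : ℚ := (lam.colLen i : ℚ) - i - 1 / 2

/-- The set `{n_1, …, n_d}` of row modes of a diagram. -/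
def rowModes (lam : YoungDiagram) : Finset ℚ := (Finset.range (diagLen lam)).image (rowMode lam)

/-- The set `{m_1, …, m_d}` of column modes of a diagram. -/
def colModes (lam : YoungDiagram) : Finset ℚ := (Finset.range (diagLen lam)).image (colMode lam)

/-- The Schur state `|s_λ⟩ = (-1)^{∑ (m_i - 1/2)} ∏_{i ≤ d(λ)} ψ_{-n_i} ψ*_{-m_i} |vac⟩`. For a
zero-based `i < d(λ)` the natural number `m_i - 1/2` is `λᵗ_i - (i + 1)`. -/
def schurState (lam : YoungDiagram) : Fock :=
  ((-1 : ℂ) ^ ∑ i ∈ Finset.range (diagLen lam), (lam.colLen i - (i + 1))) •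
    ((List.range (diagLen lam)).map
      fun i => psi (-rowMode lam i) * psiStar (-colMode lam i)).prod vac

/-- `μ` lies strictly below `λ` in dominance order: same number of boxes, partial sums of the rows
of `μ` bounded by those of `λ`, and `μ ≠ λ`. -/
def StrictlyBelow (mu lam : YoungDiagram) : Prop :=
  mu.card = lam.card ∧
    (∀ j : ℕ, ∑ i ∈ Finset.range j, mu.rowLen i ≤ ∑ i ∈ Finset.range j, lam.rowLen i) ∧
    mu ≠ lam

/-- The span of the Schur states `|s_μ⟩` with `μ` strictly below `λ`. -/
def lowerSpan (lam : YoungDiagram) : Submodule ℂ Fock :=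
  Submodule.span ℂ (schurState '' {mu | StrictlyBelow mu lam})

/-- On every Schur state `|s_λ⟩`, the operator `T` either vanishes, or it removes the row modes `R`
and the column modes `C` from `λ`, puts in the row modes `R'` and the column modes `C'`, and yields
`± |s_μ⟩` for the resulting diagram `μ`, which is strictly below `λ`. -/
def IsSqueezing (T : Module.End ℂ Fock) (R C R' C' : Finset ℚ) : Prop :=
  ∀ lam : YoungDiagram, T (schurState lam) = 0 ∨
    ∃ mu : YoungDiagram, StrictlyBelow mu lam ∧
      R ⊆ rowModes lam ∧ C ⊆ colModes lam ∧
      rowModes mu = (rowModes lam \ R) ∪ R' ∧ colModes mu = (colModes lam \ C) ∪ C' ∧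
      (T (schurState lam) = schurState mu ∨ T (schurState lam) = -schurState mu)

end

end CSFermion

open CSFermion

namespace CSFermion

/-! ### Anticommutation of the modes and normal ordering -/

/-! The quartic `:ψ_r ψ*_s ψ_k ψ*_l:` changes sign under `r ↔ k` and under `s ↔ l`, and in `H_t` its
indices sum to zero. Where `k + s > 0`, the exchange `s ↔ l` preserves both the range and the
coefficient, so this part cancels. The part with `k + s < 0` is preserved by `r ↔ k`; folding it
onto `k > r` replaces the coefficient by a difference in which `s + l` drops out and `2(k - r)`
remains (`Ht_eq_redTerm`).

The surviving region is the chain `s < -k < -r < l` with `s + l = -k - r`. Half-integers are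
nonzero, so zero lies in exactly one of the five gaps that the chain cuts out of the line. The gap
decides which modes create and which annihilate; from right to left the gaps are the families I, IV,
III, V, II (`opSum_redTerm`).

In the Maya diagram, `ψ*_x` empties the site `x` and `ψ_x` fills the site `-x`, whatever the sign of
`x`; occupied positive sites are row modes, empty negative sites are column modes with reversed
sign. So all five families do one thing: they move two particles from the outer sites `s`, `l` to
the inner sites `-k`, `-r` with the same sum. Such a squeeze cannot increase the sum of a convex
function over the particles. The functions `max (x - t) 0` give the dominance inequalities, and the
conserved sum of positions gives the conserved number of boxes (`exists_squeeze`). A Schur state is,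
up to sign, the exterior monomial determined by its occupied sites, so it suffices to follow
occupation sets and no signs (`HasOccupation`, `isSqueezing_of_occupation`). Triangularity follows
because each vector meets only finitely many terms. -/

theorem end_neg_mul (a b : Module.End ℂ Fock) : -a * b = -(a * b) := rfl

theorem end_mul_neg (a b : Module.End ℂ Fock) : a * -b = -(a * b) :=
  LinearMap.ext fun _ => map_neg a _

theorem end_neg_neg (a : Module.End ℂ Fock) : - -a = a := neg_neg a

theorem end_smul_neg (c : ℂ) (a : Module.End ℂ Fock) : c • -a = -(c • a) := smul_neg c a

theorem end_neg_smul (c : ℂ) (a : Module.End ℂ Fock) : -c • a = -(c • a) := neg_smul c a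

theorem create_mul_create (i j : ℕ ⊕ ℕ) : create i * create j = -(create j * create i) := by
  refine LinearMap.ext fun x => ?_
  have h := ExteriorAlgebra.ι_add_mul_swap (R := ℂ) (Finsupp.single i (1 : ℂ))
    (Finsupp.single j (1 : ℂ))
  have h2 := eq_neg_of_add_eq_zero_left h
  simp only [create, Module.End.mul_apply, LinearMap.neg_apply, LinearMap.mulLeft_apply,
    ← mul_assoc, h2, neg_mul]

theorem annihilate_annihilate (i j : ℕ ⊕ ℕ) (x : Fock) :
    annihilate i (annihilate j x) = -annihilate j (annihilate i x) :=
  CliffordAlgebra.contractLeft_comm _ _ _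

theorem annihilate_mul_annihilate (i j : ℕ ⊕ ℕ) :
    annihilate i * annihilate j = -(annihilate j * annihilate i) :=
  LinearMap.ext fun x => annihilate_annihilate i j x

theorem annihilate_ι_mul (i : ℕ ⊕ ℕ) (m : Modes) (x : Fock) :
    annihilate i (ExteriorAlgebra.ι ℂ m * x) =
      m i • x - ExteriorAlgebra.ι ℂ m * annihilate i x :=
  CliffordAlgebra.contractLeft_ι_mul (Q := (0 : QuadraticForm ℂ Modes)) (Finsupp.lapply i) m x

theorem annihilate_algebraMap (i : ℕ ⊕ ℕ) (c : ℂ) :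
    annihilate i (algebraMap ℂ Fock c) = 0 :=
  CliffordAlgebra.contractLeft_algebraMap (0 : QuadraticForm ℂ Modes) (Finsupp.lapply i) c

/-- The creation mode attached to a letter. -/
def Letter.mode : Letter → ℕ ⊕ ℕ
  | .psi r => if 0 < r then Sum.inr ⌊|r|⌋₊ else Sum.inl ⌊|r|⌋₊
  | .psiStar r => if 0 < r then Sum.inl ⌊|r|⌋₊ else Sum.inr ⌊|r|⌋₊

theorem Letter.op_of_pos {a : Letter} (h : 0 < a.index) : a.op = annihilate a.mode := by
  cases a <;> simp only [Letter.index] at h <;>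
    simp [Letter.op, Letter.mode, CSFermion.psi, CSFermion.psiStar, h]

theorem Letter.op_of_not_pos {a : Letter} (h : ¬ 0 < a.index) : a.op = create a.mode := by
  cases a <;> simp only [Letter.index] at h <;>
    simp [Letter.op, Letter.mode, CSFermion.psi, CSFermion.psiStar, h]

theorem Letter.op_mul_op_of_pos {a b : Letter} (ha : 0 < a.index) (hb : 0 < b.index) :
    a.op * b.op = -(b.op * a.op) := by
  rw [op_of_pos ha, op_of_pos hb, annihilate_mul_annihilate]

theorem Letter.op_mul_op_of_not_pos {a b : Letter} (ha : ¬ 0 < a.index) (hb : ¬ 0 < b.index) :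
    a.op * b.op = -(b.op * a.op) := by
  rw [op_of_not_pos ha, op_of_not_pos hb, create_mul_create]

/-- For two creators or two annihilators this is anticommutation of the operators. For a mixed pair
both sides contain the same product, and the sign arises because the annihilator passes one letter
more in one word than in the other; no contraction term appears. -/
theorem normalOrder_swap (a b : Letter) (w : List Letter) :
    normalOrder (a :: b :: w) = -normalOrder (b :: a :: w) := by
  by_cases ha : 0 < a.index <;> by_cases hb : 0 < b.index
  · simp only [normalOrder, ha, hb, if_true, List.length_cons, smul_mul_assoc, mul_assoc,
      Letter.op_mul_op_of_pos ha hb, end_mul_neg, end_smul_neg]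
    exact (neg_neg _).symm
  · simp only [normalOrder, ha, hb, if_true, if_false, List.length_cons, mul_assoc,
      mul_smul_comm, pow_succ, mul_neg_one, end_neg_smul]
  · simp only [normalOrder, ha, hb, if_true, if_false, List.length_cons, mul_assoc,
      mul_smul_comm, pow_succ, mul_neg_one, end_neg_smul]
    exact (neg_neg _).symm
  · simp only [normalOrder, ha, hb, if_false, ← mul_assoc,
      Letter.op_mul_op_of_not_pos ha hb, end_neg_mul]

/-- Equal lengths matter because a leading annihilator contributes a sign depending on the length of
the remaining word. -/
theorem normalOrder_cons_neg (a : Letter) {u w : List Letter} (hl : u.length = w.length)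
    (h : normalOrder u = -normalOrder w) : normalOrder (a :: u) = -normalOrder (a :: w) := by
  by_cases ha : 0 < a.index
  · simp only [normalOrder, ha, if_true, hl, h, end_neg_mul, end_smul_neg]
  · simp only [normalOrder, ha, if_false, h, end_mul_neg]

theorem normalOrder_swap_outer (a b c : Letter) (w : List Letter) :
    normalOrder (a :: b :: c :: w) = -normalOrder (c :: b :: a :: w) := by
  rw [normalOrder_swap a b, normalOrder_cons_neg b (by simp) (normalOrder_swap a c w),
    normalOrder_swap b c]
  simp

theorem normalQuartic_swap_psi (r s k l : ℚ) :
    normalQuartic k s r l = -normalQuartic r s k l :=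
  normalOrder_swap_outer _ _ _ _

theorem normalQuartic_swap_psiStar (r s k l : ℚ) :
    normalQuartic r l k s = -normalQuartic r s k l :=
  normalOrder_cons_neg _ rfl (normalOrder_swap_outer _ _ _ _)

/-! ### Local finiteness -/

/-- The number attached to a creation mode. -/
def level : ℕ ⊕ ℕ → ℕ := Sum.elim id id

theorem Letter.level_mode (a : Letter) : level a.mode = ⌊|a.index|⌋₊ := by
  cases a <;> simp only [Letter.mode, Letter.index] <;> split_ifs <;> rfl

/-- `v` involves no modes of level at least `N`. -/
def BoundedBy (N : ℕ) (v : Fock) : Prop := ∀ i, N ≤ level i → annihilate i v = 0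

theorem BoundedBy.annihilate {N : ℕ} {v : Fock} (hv : BoundedBy N v) (j : ℕ ⊕ ℕ) :
    BoundedBy N (annihilate j v) := fun i hi => by
  rw [annihilate_annihilate, hv i hi, map_zero, neg_zero]

theorem exists_boundedBy (v : Fock) : ∃ N, BoundedBy N v := by
  induction v using CliffordAlgebra.left_induction with
  | algebraMap c => exact ⟨0, fun i _ => annihilate_algebraMap i c⟩
  | add x y hx hy =>
    obtain ⟨M, hM⟩ := hx
    obtain ⟨N, hN⟩ := hy
    refine ⟨max M N, fun i hi => ?_⟩
    rw [map_add, hM i (le_trans (le_max_left _ _) hi), hN i (le_trans (le_max_right _ _) hi),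
      add_zero]
  | ι_mul x m hx =>
    obtain ⟨N, hN⟩ := hx
    refine ⟨max N (m.support.sup level + 1), fun i hi => ?_⟩
    have hm : m i = 0 := by
      by_contra h
      have := Finset.le_sup (f := level) (Finsupp.mem_support_iff.2 h)
      have := le_trans (le_max_right _ _) hi
      omega
    refine (annihilate_ι_mul i m x).trans ?_
    rw [hm, hN i (le_trans (le_max_left _ _) hi)]
    simp

/-- Normal ordering lets all annihilators act on `v` before any creator, and annihilators preserve
the bound, so the one of high index always kills. -/
theorem normalOrder_apply_eq_zero {N : ℕ} {a : Letter} {w : List Letter} (ha : a ∈ w)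
    (hN : (N : ℚ) < a.index) {v : Fock} (hv : BoundedBy N v) : normalOrder w v = 0 := by
  induction w generalizing v with
  | nil => simp at ha
  | cons b w ih =>
    by_cases hb : 0 < b.index
    · simp only [normalOrder, hb, if_true, LinearMap.smul_apply, Module.End.mul_apply,
        Letter.op_of_pos hb]
      rcases List.mem_cons.1 ha with rfl | h
      · rw [hv, map_zero, smul_zero]
        rw [Letter.level_mode, abs_of_pos hb]
        exact Nat.le_floor hN.le
      · rw [ih h (hv.annihilate _), smul_zero]
    · simp only [normalOrder, hb, if_false, Module.End.mul_apply]
      rcases List.mem_cons.1 ha with rfl | h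
      · exact absurd (lt_of_le_of_lt (Nat.cast_nonneg N) hN) hb
      · rw [ih h hv, map_zero]

theorem finite_halfInt_Icc (a b : ℚ) : {r | r ∈ HalfInt ∧ a ≤ r ∧ r ≤ b}.Finite := by
  refine ((Set.finite_Icc (⌊a⌋ - 1) ⌈b⌉).image fun n : ℤ => (n : ℚ) + 1 / 2).subset ?_
  rintro _ ⟨⟨n, rfl⟩, h1, h2⟩
  refine ⟨n, ⟨?_, ?_⟩, rfl⟩
  · have h3 := Int.floor_le a
    have : ((⌊a⌋ - 1 : ℤ) : ℚ) < n + 1 := by push_cast; linarith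
    have : ⌊a⌋ - 1 < n + 1 := by exact_mod_cast this
    omega
  · have h3 := Int.le_ceil b
    have : (n : ℚ) ≤ ⌈b⌉ := by linarith
    exact_mod_cast this

/-- The half-integral quadruples of sum zero. -/
def balancedQuads : Set Quad :=
  {q | q.r ∈ HalfInt ∧ q.s ∈ HalfInt ∧ q.k ∈ HalfInt ∧ q.l ∈ HalfInt ∧ q.r + q.s + q.k + q.l = 0}

/-- If the quartic does not kill `v`, all four indices are at most some `N`; since they sum to zero,
each is at least `-3N`, which leaves finitely many half-integers. Local finiteness of all the other
sums is deduced from this one by reindexing and rescaling. -/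
theorem locFinite_normalQuartic :
    LocFinite balancedQuads fun q => normalQuartic q.r q.s q.k q.l := by
  intro v
  obtain ⟨N, hN⟩ := exists_boundedBy v
  have hB := finite_halfInt_Icc (-(3 * N)) N
  set B := {r : ℚ | r ∈ HalfInt ∧ -(3 * (N : ℚ)) ≤ r ∧ r ≤ N}
  refine ((((hB.prod hB).prod (hB.prod hB))).image
    fun x => Quad.mk x.1.1 x.1.2 x.2.1 x.2.2).subset ?_
  rintro ⟨r, s, k, l⟩ ⟨⟨hr, hs, hk, hl, h0⟩, hv⟩
  simp only at hr hs hk hl h0 hv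
  have key : ∀ a ∈ [Letter.psi r, Letter.psiStar s, Letter.psi k, Letter.psiStar l],
      a.index ≤ N := fun a ha => by
    by_contra h
    exact hv (normalOrder_apply_eq_zero ha (not_le.1 h) hN)
  have h1 : r ≤ N := key (Letter.psi r) (by simp)
  have h2 : s ≤ N := key (Letter.psiStar s) (by simp)
  have h3 : k ≤ N := key (Letter.psi k) (by simp)
  have h4 : l ≤ N := key (Letter.psiStar l) (by simp)
  exact ⟨((r, s), (k, l)), ⟨⟨⟨hr, by linarith, h1⟩, ⟨hs, by linarith, h2⟩⟩,
    ⟨⟨hk, by linarith, h3⟩, ⟨hl, by linarith, h4⟩⟩⟩, rfl⟩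

theorem LocFinite.comp {ι κ : Type} {S : Set ι} {T : ι → Module.End ℂ Fock} (h : LocFinite S T)
    {S' : Set κ} (f : κ → ι) (hf : Set.MapsTo f S' S) (hinj : Set.InjOn f S')
    {T' : κ → Module.End ℂ Fock} (hT : ∀ i ∈ S', ∃ c : ℂ, T' i = c • T (f i)) :
    LocFinite S' T' := by
  intro v
  refine Set.Finite.of_finite_image (f := f) ((h v).subset ?_) (hinj.mono fun i hi => hi.1)
  rintro _ ⟨i, ⟨hi, hv⟩, rfl⟩
  refine ⟨hf hi, fun h0 => hv ?_⟩
  obtain ⟨c, hc⟩ := hT i hi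
  rw [hc, LinearMap.smul_apply, h0, smul_zero]

theorem opSum_apply {ι : Type} {S : Set ι} {T : ι → Module.End ℂ Fock} (h : LocFinite S T)
    (v : Fock) : opSum S T v = ∑ᶠ i ∈ S, T i v := by
  rw [opSum, dif_pos h]
  exact finsum_set_coe_eq_finsum_mem (f := fun i => T i v) S

/-! ### Reduction of `H_t` -/

theorem locFinite_redTerm : LocFinite redRange redTerm :=
  locFinite_normalQuartic.comp id (fun _ h => ⟨h.1, h.2.1, h.2.2.1, h.2.2.2.1, h.2.2.2.2.2.2.2⟩)
    (Set.injOn_id _) fun _ _ => ⟨_, rfl⟩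

theorem halfInt_neg {r : ℚ} : r ∈ HalfInt → -r ∈ HalfInt := by
  rintro ⟨n, rfl⟩
  exact ⟨-n - 1, by push_cast; ring⟩

theorem halfInt_add_add {r s t : ℚ} : r ∈ HalfInt → s ∈ HalfInt → t ∈ HalfInt →
    r + s + t ∈ HalfInt := by
  rintro ⟨a, rfl⟩ ⟨b, rfl⟩ ⟨c, rfl⟩
  exact ⟨a + b + c + 1, by push_cast; ring⟩

theorem halfInt_neg_sub_sub {s k l : ℚ} (hs : s ∈ HalfInt) (hk : k ∈ HalfInt) (hl : l ∈ HalfInt) :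
    -s - k - l ∈ HalfInt := by
  convert halfInt_neg (halfInt_add_add hs hk hl) using 1
  ring

/-- The balanced quadruple of a triple. -/
def Triple.toQuad (t : Triple) : Quad := ⟨-t.s - t.k - t.l, t.s, t.k, t.l⟩

theorem Triple.toQuad_injective : Function.Injective Triple.toQuad := by
  rintro ⟨s, k, l⟩ ⟨s', k', l'⟩ h
  simp only [toQuad, Quad.mk.injEq] at h
  simp [h]

theorem locFinite_HtTerm : LocFinite HtRange HtTerm :=
  locFinite_normalQuartic.comp Triple.toQuad
    (fun _ h => ⟨halfInt_neg_sub_sub h.1 h.2.1 h.2.2.1, h.1, h.2.1, h.2.2.1, by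
      simp only [Triple.toQuad]; ring⟩)
    Triple.toQuad_injective.injOn fun _ _ => ⟨_, rfl⟩

/-- The image of the summation range of `H_t` under `Triple.toQuad`. -/
def quadRange : Set Quad :=
  {q | q ∈ balancedQuads ∧ 0 < q.k + q.l ∧ q.k + q.s ≠ 0}

theorem bijOn_toQuad : Set.BijOn Triple.toQuad HtRange quadRange := by
  refine ⟨?_, Triple.toQuad_injective.injOn, ?_⟩
  · rintro t ⟨hs, hk, hl, h1, h2⟩
    exact ⟨⟨halfInt_neg_sub_sub hs hk hl, hs, hk, hl, by simp only [Triple.toQuad]; ring⟩, h1, h2⟩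
  · rintro ⟨r, s, k, l⟩ ⟨⟨hr, hs, hk, hl, h0⟩, h1, h2⟩
    simp only at hr hs hk hl h0 h1 h2
    refine ⟨⟨s, k, l⟩, ⟨hs, hk, hl, h1, h2⟩, ?_⟩
    simp only [Triple.toQuad, Quad.mk.injEq, and_true]
    linarith

/-- Interchange of the two `ψ`-indices. -/
def Quad.swapPsi (q : Quad) : Quad := ⟨q.k, q.s, q.r, q.l⟩

/-- Interchange of the two `ψ*`-indices. -/
def Quad.swapPsiStar (q : Quad) : Quad := ⟨q.r, q.l, q.k, q.s⟩

theorem bijOn_of_involutive {α : Type} {f : α → α} (hf : Function.Involutive f) {S S' : Set α}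
    (h : Set.MapsTo f S S') (h' : Set.MapsTo f S' S) : Set.BijOn f S S' :=
  ⟨h, hf.injective.injOn, fun y hy => ⟨f y, h' hy, hf y⟩⟩

theorem Ht_eq_redTerm : Ht = (2 : ℂ) • opSum redRange redTerm := by
  refine LinearMap.ext fun v => ?_
  set f : Quad → Fock := fun q => normalQuartic q.r q.s q.k q.l v with hf
  set g : Quad → Fock := fun q => ((2 * q.k + 2 / 3 * (q.s + q.l) : ℚ) : ℂ) • f q with hg
  have hsupp : ∀ S ⊆ balancedQuads, (S ∩ Function.support g).Finite := fun S hS =>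
    (locFinite_normalQuartic v).subset fun q hq => ⟨hS hq.1, fun h0 => hq.2 (by
      simp only [hg]; rw [show f q = 0 from h0, smul_zero])⟩
  have hflip : ∀ q : Quad, f q.swapPsi = -f q := fun q => by
    simp only [hf, Quad.swapPsi, normalQuartic_swap_psi q.r q.s q.k q.l, LinearMap.neg_apply]
  have hflip' : ∀ q : Quad, f q.swapPsiStar = -f q := fun q => by
    simp only [hf, Quad.swapPsiStar, normalQuartic_swap_psiStar q.r q.s q.k q.l,
      LinearMap.neg_apply]
  have hinv : Function.Involutive Quad.swapPsi := fun _ => rfl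
  have hinv' : Function.Involutive Quad.swapPsiStar := fun _ => rfl
  have h1 : Ht v = ∑ᶠ q ∈ quadRange, g q := by
    rw [Ht, opSum_apply locFinite_HtTerm]
    exact finsum_mem_eq_of_bijOn _ bijOn_toQuad fun t _ => rfl
  set A : Set Quad := {q | q ∈ balancedQuads ∧ 0 < q.k + q.l ∧ 0 < q.k + q.s}
  set B : Set Quad := {q | q ∈ balancedQuads ∧ 0 < q.k + q.l ∧ q.k + q.s < 0 ∧ q.r < q.k}
  set C : Set Quad := {q | q ∈ balancedQuads ∧ 0 < q.k + q.l ∧ q.k + q.s < 0 ∧ q.k < q.r}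
  set D : Set Quad := {q | q ∈ balancedQuads ∧ 0 < q.k + q.l ∧ q.k + q.s < 0 ∧ q.k = q.r}
  have hred : B = redRange := by
    ext q
    constructor
    · rintro ⟨⟨hr, hs, hk, hl, h0⟩, h2, h3, h4⟩
      exact ⟨hr, hs, hk, hl, h2, h3, h4, h0⟩
    · rintro ⟨hr, hs, hk, hl, h2, h3, h4, h0⟩
      exact ⟨⟨hr, hs, hk, hl, h0⟩, h2, h3, h4⟩
  have hunion : quadRange = A ∪ (B ∪ (C ∪ D)) := by
    ext q
    constructor
    · rintro ⟨hq, h2, h3⟩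
      rcases lt_or_gt_of_ne h3 with h | h
      · rcases lt_trichotomy q.r q.k with h' | h' | h'
        · exact Or.inr (Or.inl ⟨hq, h2, h, h'⟩)
        · exact Or.inr (Or.inr (Or.inr ⟨hq, h2, h, h'.symm⟩))
        · exact Or.inr (Or.inr (Or.inl ⟨hq, h2, h, h'⟩))
      · exact Or.inl ⟨hq, h2, h⟩
    · rintro (⟨hq, h2, h3⟩ | ⟨hq, h2, h3, -⟩ | ⟨hq, h2, h3, -⟩ | ⟨hq, h2, h3, -⟩)
      exacts [⟨hq, h2, h3.ne'⟩, ⟨hq, h2, h3.ne⟩, ⟨hq, h2, h3.ne⟩, ⟨hq, h2, h3.ne⟩]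
  have hdisj1 : Disjoint A (B ∪ (C ∪ D)) := by
    rw [Set.disjoint_left]
    rintro q ⟨-, -, h⟩ (⟨-, -, h', -⟩ | ⟨-, -, h', -⟩ | ⟨-, -, h', -⟩) <;> exact lt_asymm h h'
  have hdisj2 : Disjoint B (C ∪ D) := by
    rw [Set.disjoint_left]
    rintro q ⟨-, -, -, h⟩ (⟨-, -, -, h'⟩ | ⟨-, -, -, h'⟩)
    · exact lt_asymm h h'
    · exact h.ne' h'
  have hdisj3 : Disjoint C D := by
    rw [Set.disjoint_left]
    rintro q ⟨-, -, -, h⟩ ⟨-, -, -, h'⟩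
    exact h.ne h'
  -- The exchange `s ↔ l` interchanges the two inequalities defining `A`, fixes the coefficient and
  -- negates the quartic, so the sum equals its own negative.
  have hA : ∑ᶠ q ∈ A, g q = 0 := by
    have e : ∑ᶠ q ∈ A, g q = ∑ᶠ q ∈ A, -g q := by
      refine finsum_mem_eq_of_bijOn Quad.swapPsiStar (bijOn_of_involutive hinv' ?_ ?_) ?_
      · rintro q ⟨⟨hr, hs, hk, hl, h0⟩, h2, h3⟩
        exact ⟨⟨hr, hl, hk, hs, by simp only [Quad.swapPsiStar]; linarith⟩, h3, h2⟩
      · rintro q ⟨⟨hr, hs, hk, hl, h0⟩, h2, h3⟩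
        exact ⟨⟨hr, hl, hk, hs, by simp only [Quad.swapPsiStar]; linarith⟩, h3, h2⟩
      · intro q _
        simp only [hg, hflip', smul_neg, neg_neg]
        simp only [Quad.swapPsiStar, add_comm]
    have hfin := hsupp A fun q hq => hq.1
    have e2 : ∑ᶠ q ∈ A, g q + ∑ᶠ q ∈ A, -g q = 0 := by
      rw [← finsum_mem_add_distrib' hfin (by simpa using hfin)]
      simp
    rw [← e, ← two_smul ℂ] at e2
    exact (smul_eq_zero.1 e2).resolve_left two_ne_zero
  have hD : ∑ᶠ q ∈ D, g q = 0 := by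
    refine finsum_mem_of_eqOn_zero fun q hq => ?_
    have hq' : q.swapPsi = q := by
      obtain ⟨r, s, k, l⟩ := q
      have : k = r := hq.2.2.2
      simp [Quad.swapPsi, this]
    have e := hflip q
    rw [hq', eq_neg_iff_add_eq_zero, ← two_smul ℂ] at e
    simp only [hg, (smul_eq_zero.1 e).resolve_left two_ne_zero, smul_zero, Pi.zero_apply]
  -- Total sum zero turns `k + l > 0` into `r + s < 0` and `k + s < 0` into `r + l > 0`; hence `r ↔
  -- k` exchanges `B` and `C`.
  have hC : ∑ᶠ q ∈ C, g q = ∑ᶠ q ∈ B, g q.swapPsi := by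
    symm
    refine finsum_mem_eq_of_bijOn Quad.swapPsi (bijOn_of_involutive hinv ?_ ?_) fun _ _ => rfl
    · rintro q ⟨⟨hr, hs, hk, hl, h0⟩, h2, h3, h4⟩
      refine ⟨⟨hk, hs, hr, hl, ?_⟩, ?_, ?_, h4⟩ <;> simp only [Quad.swapPsi] <;> linarith
    · rintro q ⟨⟨hr, hs, hk, hl, h0⟩, h2, h3, h4⟩
      refine ⟨⟨hk, hs, hr, hl, ?_⟩, ?_, ?_, h4⟩ <;> simp only [Quad.swapPsi] <;> linarith
  have hBb : B ⊆ balancedQuads := fun q hq => hq.1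
  have hfinB : (B ∩ Function.support fun q => g q.swapPsi).Finite :=
    (locFinite_normalQuartic v).subset fun q hq => ⟨hBb hq.1, fun h0 => hq.2 (by
      simp only [hg]; rw [hflip, show f q = 0 from h0, neg_zero, smul_zero])⟩
  rw [h1, hunion, finsum_mem_union' hdisj1 (hsupp _ fun q hq => hq.1) (hsupp _ ?_), hA, zero_add,
    finsum_mem_union' hdisj2 (hsupp _ hBb) (hsupp _ ?_),
    finsum_mem_union' hdisj3 (hsupp _ fun q hq => hq.1) (hsupp _ fun q hq => hq.1), hD, add_zero,
    hC, ← finsum_mem_add_distrib' (hsupp _ hBb) hfinB, LinearMap.smul_apply,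
    opSum_apply locFinite_redTerm, hred]
  · simp only [smul_finsum]
    refine finsum_mem_congr rfl fun q hq => ?_
    have h0 : q.r + q.s + q.k + q.l = 0 := hq.2.2.2.2.2.2.2
    simp only [hg, hflip, redTerm, LinearMap.smul_apply, smul_neg]
    -- The folded coefficient is the difference of the two original ones; both contain the same `2/3
    -- (s + l)`.
    rw [← sub_eq_add_neg, ← sub_smul, smul_smul]
    congr 1
    simp only [Quad.swapPsi]
    rw [show q.l = -(q.r + q.s + q.k) by linarith]
    push_cast
    ring
  · rintro q (h | h) <;> exact h.1
  · rintro q (h | h | h) <;> exact h.1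

/-! ### The five regions -/

/-- Each annihilator in turn is sent to the far right, so annihilators come out in reverse order:
here as `ψ*_s ψ*_l ψ_k ψ_r`, with sign `+`. One transposition then gives the process. The other
patterns with several annihilators are treated alike. -/
theorem normalQuartic_eq_neg_procI {r s k l : ℚ} (hr : 0 < r) (hs : s < 0) (hk : 0 < k)
    (hl : l < 0) : normalQuartic r s k l = -(psiStar s * psiStar l * psi r * psi k) := by
  have h := Letter.op_mul_op_of_pos (a := .psi r) (b := .psi k) hr hk
  simp only [Letter.op] at h
  simp only [normalQuartic, normalOrder, Letter.index, Letter.op, hr, hk, hs.not_gt, hl.not_gt,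
    if_true, if_false, List.length, mul_one, mul_assoc, h, end_mul_neg, zero_add]
  norm_num [end_neg_smul, end_neg_mul, end_mul_neg, end_neg_neg, mul_assoc]

theorem normalQuartic_eq_neg_procII {r s k l : ℚ} (hr : r < 0) (hs : 0 < s) (hk : k < 0)
    (hl : 0 < l) : normalQuartic r s k l = -(psi r * psi k * psiStar s * psiStar l) := by
  have h := Letter.op_mul_op_of_pos (a := .psiStar s) (b := .psiStar l) hs hl
  simp only [Letter.op] at h
  simp only [normalQuartic, normalOrder, Letter.index, Letter.op, hs, hl, hr.not_gt, hk.not_gt,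
    if_true, if_false, List.length, mul_one, mul_assoc, h, end_mul_neg, zero_add]
  norm_num [end_neg_smul, end_neg_mul, end_mul_neg, end_neg_neg, mul_assoc]

theorem normalQuartic_eq_procIII {r s k l : ℚ} (hr : r < 0) (hs : s < 0) (hk : 0 < k)
    (hl : 0 < l) : normalQuartic r s k l = psi r * psiStar s * psi k * psiStar l := by
  have h := Letter.op_mul_op_of_pos (a := .psi k) (b := .psiStar l) hk hl
  simp only [Letter.op] at h
  simp only [normalQuartic, normalOrder, Letter.index, Letter.op, hk, hl, hr.not_gt, hs.not_gt,
    if_true, if_false, List.length, mul_one, mul_assoc, h, end_mul_neg, zero_add]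
  norm_num [end_neg_smul, end_neg_mul, end_mul_neg, end_neg_neg, mul_assoc]

theorem normalQuartic_eq_neg_procIV {r s k l : ℚ} (hr : 0 < r) (hs : s < 0) (hk : 0 < k)
    (hl : 0 < l) : normalQuartic r s k l = -(psiStar s * psi r * psi k * psiStar l) := by
  have h := Letter.op_mul_op_of_pos (a := .psi r) (b := .psi k) hr hk
  have h2 := Letter.op_mul_op_of_pos (a := .psi r) (b := .psiStar l) hr hl
  have h3 := Letter.op_mul_op_of_pos (a := .psi k) (b := .psiStar l) hk hl
  simp only [Letter.op] at h h2 h3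
  -- Reversing three pairwise anticommuting operators is an odd permutation.
  have h4 : psi r * (psi k * psiStar l) = -(psiStar l * (psi k * psi r)) := by
    rw [h3, end_mul_neg, ← mul_assoc, h2, end_neg_mul, mul_assoc, h, end_mul_neg,
      end_neg_neg]
  simp only [normalQuartic, normalOrder, Letter.index, Letter.op, hk, hl, hr, hs.not_gt,
    if_true, if_false, List.length, mul_one, mul_assoc, h4, end_mul_neg, zero_add]
  norm_num [end_neg_smul, end_neg_mul, end_mul_neg, end_neg_neg, mul_assoc]

theorem normalQuartic_eq_procV {r s k l : ℚ} (hr : r < 0) (hs : s < 0) (hk : k < 0)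
    (hl : 0 < l) : normalQuartic r s k l = psi r * psiStar s * psi k * psiStar l := by
  simp only [normalQuartic, normalOrder, Letter.index, Letter.op, hl, hr.not_gt, hs.not_gt,
    hk.not_gt, if_true, if_false, List.length, mul_assoc]
  norm_num

/-- The quadruple of a process of family I. -/
def quadI (p : ParamN) : Quad := ⟨p.r, -p.k - p.n, p.k, -p.r + p.n⟩

/-- The quadruple of a process of family II. -/
def quadII (p : ParamN) : Quad := ⟨-p.k + p.n, p.r, -p.r - p.n, p.k⟩

/-- The quadruple of a process of family III. -/
def quadIII (p : ParamN) : Quad := ⟨-p.r + p.n, -p.k - p.n, p.k, p.r⟩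

/-- The quadruple of a process of family IV. -/
def quadIV (p : ParamS) : Quad := ⟨p.r, -p.r - p.s - p.k, p.k, p.s⟩

/-- The quadruple of a process of family V. -/
def quadV (p : ParamS) : Quad := ⟨-p.k, -p.s, -p.r, p.r + p.s + p.k⟩

theorem termI_eq_redTerm {p : ParamN} (hp : p ∈ rangeI) : termI p = redTerm (quadI p) := by
  obtain ⟨-, -, h1, h2, h3, h4⟩ := hp
  have h3' : (1 : ℚ) ≤ p.n := by exact_mod_cast h3
  rw [redTerm, quadI, normalQuartic_eq_neg_procI h1 (by linarith) (by linarith) (by linarith),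
    end_smul_neg, ← end_neg_smul, termI, procI]
  congr 1
  push_cast
  ring

theorem termII_eq_redTerm {p : ParamN} (hp : p ∈ rangeII) : termII p = redTerm (quadII p) := by
  obtain ⟨-, -, h1, h2, h3, h4⟩ := hp
  have h3' : (1 : ℚ) ≤ p.n := by exact_mod_cast h3
  have h4' := Int.le_floor.1 h4
  push_cast at h4'
  rw [redTerm, quadII, normalQuartic_eq_neg_procII (by linarith) h1 (by linarith) (by linarith),
    end_smul_neg, ← end_neg_smul, termII, procII]
  congr 1
  push_cast
  ring

theorem termIII_eq_redTerm {p : ParamN} (hp : p ∈ rangeIII) :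
    termIII p = redTerm (quadIII p) := by
  obtain ⟨-, -, h1, h2, h3, h4⟩ := hp
  have h3' : (1 : ℚ) ≤ p.n := by exact_mod_cast h3
  rw [redTerm, quadIII, normalQuartic_eq_procIII (by linarith) (by linarith) h1 h2,
    termIII, procIII]
  congr 1
  push_cast
  ring

theorem termIV_eq_redTerm {p : ParamS} (hp : p ∈ rangeIV) : termIV p = redTerm (quadIV p) := by
  obtain ⟨-, -, -, h1, h2, h3⟩ := hp
  rw [redTerm, quadIV, normalQuartic_eq_neg_procIV h1 (by linarith) (by linarith) h3,
    end_smul_neg, ← end_neg_smul, termIV, procIV]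
  congr 1
  push_cast
  ring

theorem termV_eq_redTerm {p : ParamS} (hp : p ∈ rangeV) : termV p = redTerm (quadV p) := by
  obtain ⟨-, -, -, h1, h2, h3⟩ := hp
  rw [redTerm, quadV, normalQuartic_eq_procV (by linarith) (by linarith) (by linarith)
    (by linarith), termV, procV]
  congr 1
  push_cast
  ring

/-! ### Arithmetic of half-integers and parametrization of the five regions -/

theorem halfInt_add_int {r : ℚ} (hr : r ∈ HalfInt) (n : ℤ) : r + n ∈ HalfInt := by
  obtain ⟨a, rfl⟩ := hr
  exact ⟨a + n, by push_cast; ring⟩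

theorem halfInt_add_nat {r : ℚ} (hr : r ∈ HalfInt) (n : ℕ) : r + n ∈ HalfInt :=
  halfInt_add_int hr n

theorem halfInt_sub_nat {r : ℚ} (hr : r ∈ HalfInt) (n : ℕ) : r - n ∈ HalfInt := by
  simpa [sub_eq_add_neg] using halfInt_add_int hr (-n)

theorem halfInt_ne_zero {r : ℚ} (hr : r ∈ HalfInt) : r ≠ 0 := by
  obtain ⟨a, rfl⟩ := hr
  intro h
  have : ((2 * a + 1 : ℤ) : ℚ) = 0 := by push_cast; linarith
  have : 2 * a + 1 = 0 := by exact_mod_cast this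
  omega

theorem exists_nat_eq_sub {r s : ℚ} (hr : r ∈ HalfInt) (hs : s ∈ HalfInt) (h : s < r) :
    ∃ n : ℕ, 1 ≤ n ∧ (n : ℚ) = r - s := by
  obtain ⟨a, rfl⟩ := hr
  obtain ⟨b, rfl⟩ := hs
  have h' : b < a := by
    have : (b : ℚ) < a := by linarith
    exact_mod_cast this
  obtain ⟨n, hn⟩ := Int.eq_ofNat_of_zero_le (sub_nonneg.2 h'.le)
  refine ⟨n, by omega, ?_⟩
  have : ((n : ℤ) : ℚ) = ((a - b : ℤ) : ℚ) := by rw [hn]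
  push_cast at this
  linarith

theorem half_le_of_halfInt_pos {r : ℚ} (hr : r ∈ HalfInt) (h : 0 < r) : 1 / 2 ≤ r := by
  obtain ⟨a, rfl⟩ := hr
  have : ((-1 : ℤ) : ℚ) < a := by push_cast; linarith
  have : (-1 : ℤ) < a := by exact_mod_cast this
  have : ((0 : ℤ) : ℚ) ≤ a := by exact_mod_cast this
  push_cast at this
  linarith

/-- The parameter `n` is recovered as `-s - k`, the distance each particle moves; it is a positive
integer because `k + s < 0`. For half-integers the bound `n ≤ r - 1/2` is the condition `l < 0`. -/
theorem bijOn_quadI : Set.BijOn quadI rangeI {q | q ∈ redRange ∧ 0 < q.r ∧ q.l < 0} := by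
  refine ⟨?_, ?_, ?_⟩
  · rintro ⟨k, r, n⟩ ⟨hk, hr, h1, h2, h3, h4⟩
    simp only at hk hr h1 h2 h3 h4
    have h3' : (1 : ℚ) ≤ n := by exact_mod_cast h3
    refine ⟨⟨hr, halfInt_sub_nat (halfInt_neg hk) n, hk, halfInt_add_nat (halfInt_neg hr) n,
      ?_, ?_, h2, ?_⟩, h1, ?_⟩ <;> simp only [quadI] <;> linarith
  · rintro ⟨k, r, n⟩ - ⟨k', r', n'⟩ - h
    simp only [quadI, Quad.mk.injEq] at h
    obtain ⟨rfl, h2, rfl, -⟩ := h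
    simpa using h2
  · rintro ⟨r, s, k, l⟩ ⟨⟨hr, hs, hk, hl, h1, h2, h3, h0⟩, h4, h5⟩
    simp only at hr hs hk hl h1 h2 h3 h4 h5 h0
    obtain ⟨n, hn, e⟩ := exists_nat_eq_sub (halfInt_neg hs) hk (by linarith)
    have := half_le_of_halfInt_pos (halfInt_neg hl) (by linarith)
    refine ⟨⟨k, r, n⟩, ⟨hk, hr, h4, h3, hn, by simp only; linarith⟩, ?_⟩
    simp only [quadI, Quad.mk.injEq, true_and]
    constructor <;> linarith

theorem bijOn_quadII : Set.BijOn quadII rangeII {q | q ∈ redRange ∧ q.k < 0 ∧ 0 < q.s} := by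
  refine ⟨?_, ?_, ?_⟩
  · rintro ⟨k, r, n⟩ ⟨hk, hr, h1, h2, h3, h4⟩
    simp only at hk hr h1 h2 h3 h4
    have h3' : (1 : ℚ) ≤ n := by exact_mod_cast h3
    have h4' := Int.le_floor.1 h4
    push_cast at h4'
    refine ⟨⟨halfInt_add_nat (halfInt_neg hk) n, hr, halfInt_sub_nat (halfInt_neg hr) n, hk,
      ?_, ?_, ?_, ?_⟩, ?_, h1⟩ <;> simp only [quadII] <;> linarith
  · rintro ⟨k, r, n⟩ - ⟨k', r', n'⟩ - h
    simp only [quadII, Quad.mk.injEq] at h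
    obtain ⟨h2, rfl, -, rfl⟩ := h
    simpa using h2
  · rintro ⟨r, s, k, l⟩ ⟨⟨hr, hs, hk, hl, h1, h2, h3, h0⟩, h4, h5⟩
    simp only at hr hs hk hl h1 h2 h3 h4 h5 h0
    obtain ⟨n, hn, e⟩ := exists_nat_eq_sub (halfInt_neg hk) hs (by linarith)
    -- Integrality sharpens `r < k` to `k - r ≥ 1`, which is what the integer part in the range of
    -- `n` requires.
    obtain ⟨m, hm, e'⟩ := exists_nat_eq_sub hk hr h3
    have hm' : (1 : ℚ) ≤ m := by exact_mod_cast hm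
    refine ⟨⟨l, s, n⟩, ⟨hl, hs, h5, by simp only; linarith, hn, ?_⟩, ?_⟩
    · rw [Int.le_floor]
      push_cast
      linarith
    · simp only [quadII, Quad.mk.injEq, true_and, and_true]
      constructor <;> linarith

theorem bijOn_quadIII : Set.BijOn quadIII rangeIII {q | q ∈ redRange ∧ q.r < 0 ∧ 0 < q.k} := by
  refine ⟨?_, ?_, ?_⟩
  · rintro ⟨k, r, n⟩ ⟨hk, hr, h1, h2, h3, h4⟩
    simp only at hk hr h1 h2 h3 h4
    have h3' : (1 : ℚ) ≤ n := by exact_mod_cast h3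
    refine ⟨⟨halfInt_add_nat (halfInt_neg hr) n, halfInt_sub_nat (halfInt_neg hk) n, hk, hr,
      ?_, ?_, ?_, ?_⟩, ?_, h1⟩ <;> simp only [quadIII] <;> linarith
  · rintro ⟨k, r, n⟩ - ⟨k', r', n'⟩ - h
    simp only [quadIII, Quad.mk.injEq] at h
    obtain ⟨h2, -, rfl, rfl⟩ := h
    simpa using h2
  · rintro ⟨r, s, k, l⟩ ⟨⟨hr, hs, hk, hl, h1, h2, h3, h0⟩, h4, h5⟩
    simp only at hr hs hk hl h1 h2 h3 h4 h5 h0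
    obtain ⟨n, hn, e⟩ := exists_nat_eq_sub (halfInt_neg hs) hk (by linarith)
    have := half_le_of_halfInt_pos (halfInt_neg hr) (by linarith)
    refine ⟨⟨k, l, n⟩, ⟨hk, hl, h5, by simp only; linarith, hn, by simp only; linarith⟩, ?_⟩
    simp only [quadIII, Quad.mk.injEq, and_true]
    constructor <;> linarith

theorem bijOn_quadIV : Set.BijOn quadIV rangeIV {q | q ∈ redRange ∧ 0 < q.r ∧ 0 < q.l} := by
  refine ⟨?_, ?_, ?_⟩
  · rintro ⟨k, r, s⟩ ⟨hk, hr, hs, h1, h2, h3⟩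
    simp only at hk hr hs h1 h2 h3
    refine ⟨⟨hr, halfInt_neg_sub_sub hr hs hk, hk, hs, ?_, ?_, h2, ?_⟩, h1, h3⟩ <;>
      simp only [quadIV] <;> linarith
  · rintro ⟨k, r, s⟩ - ⟨k', r', s'⟩ - h
    simp only [quadIV, Quad.mk.injEq] at h
    obtain ⟨rfl, -, rfl, rfl⟩ := h
    rfl
  · rintro ⟨r, s, k, l⟩ ⟨⟨hr, hs, hk, hl, h1, h2, h3, h0⟩, h4, h5⟩
    simp only at hr hs hk hl h1 h2 h3 h4 h5 h0
    refine ⟨⟨k, r, l⟩, ⟨hk, hr, hl, h4, h3, h5⟩, ?_⟩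
    simp only [quadIV, Quad.mk.injEq, true_and, and_true]
    linarith

theorem bijOn_quadV : Set.BijOn quadV rangeV {q | q ∈ redRange ∧ q.k < 0 ∧ q.s < 0} := by
  refine ⟨?_, ?_, ?_⟩
  · rintro ⟨k, r, s⟩ ⟨hk, hr, hs, h1, h2, h3⟩
    simp only at hk hr hs h1 h2 h3
    refine ⟨⟨halfInt_neg hk, halfInt_neg hs, halfInt_neg hr, halfInt_add_add hr hs hk,
      ?_, ?_, ?_, ?_⟩, ?_, ?_⟩ <;> simp only [quadV] <;> linarith
  · rintro ⟨k, r, s⟩ - ⟨k', r', s'⟩ - h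
    simp only [quadV, Quad.mk.injEq, neg_inj] at h
    obtain ⟨rfl, rfl, rfl, -⟩ := h
    rfl
  · rintro ⟨r, s, k, l⟩ ⟨⟨hr, hs, hk, hl, h1, h2, h3, h0⟩, h4, h5⟩
    simp only at hr hs hk hl h1 h2 h3 h4 h5 h0
    refine ⟨⟨-r, -k, -s⟩, ⟨halfInt_neg hr, halfInt_neg hk, halfInt_neg hs, ?_, ?_, ?_⟩, ?_⟩
    · simp only; linarith
    · simp only; linarith
    · simp only; linarith
    simp only [quadV, Quad.mk.injEq, neg_neg, true_and]
    linarith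

/-! ### Summation over the five regions -/

theorem LocFinite.of_bijOn {ι κ : Type} {S S' : Set ι} {T : ι → Module.End ℂ Fock}
    (h : LocFinite S T) (hS : S' ⊆ S) {P : Set κ} {f : κ → ι} (hf : Set.BijOn f P S')
    {T' : κ → Module.End ℂ Fock} (hT : ∀ p ∈ P, T' p = T (f p)) : LocFinite P T' :=
  h.comp f (fun _ hp => hS (hf.1 hp)) hf.2.1 fun p hp => ⟨1, by rw [hT p hp, one_smul]⟩

theorem locFinite_termI : LocFinite rangeI termI :=
  locFinite_redTerm.of_bijOn (fun _ h => h.1) bijOn_quadI fun _ => termI_eq_redTerm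

theorem locFinite_termII : LocFinite rangeII termII :=
  locFinite_redTerm.of_bijOn (fun _ h => h.1) bijOn_quadII fun _ => termII_eq_redTerm

theorem locFinite_termIII : LocFinite rangeIII termIII :=
  locFinite_redTerm.of_bijOn (fun _ h => h.1) bijOn_quadIII fun _ => termIII_eq_redTerm

theorem locFinite_termIV : LocFinite rangeIV termIV :=
  locFinite_redTerm.of_bijOn (fun _ h => h.1) bijOn_quadIV fun _ => termIV_eq_redTerm

theorem locFinite_termV : LocFinite rangeV termV :=
  locFinite_redTerm.of_bijOn (fun _ h => h.1) bijOn_quadV fun _ => termV_eq_redTerm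

theorem opSum_apply_of_bijOn {ι κ : Type} {S' : Set ι} {T : ι → Module.End ℂ Fock}
    {P : Set κ} {f : κ → ι} (hf : Set.BijOn f P S')
    {T' : κ → Module.End ℂ Fock} (hT : ∀ p ∈ P, T' p = T (f p)) (h : LocFinite P T') (v : Fock) :
    opSum P T' v = ∑ᶠ q ∈ S', T q v := by
  rw [opSum_apply h]
  exact finsum_mem_eq_of_bijOn f hf fun p hp => by rw [hT p hp]

theorem opSum_redTerm : opSum redRange redTerm = opSum rangeI termI + opSum rangeII termII +
    opSum rangeIII termIII + opSum rangeIV termIV + opSum rangeV termV := by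
  refine LinearMap.ext fun v => ?_
  simp only [LinearMap.add_apply]
  rw [opSum_apply_of_bijOn bijOn_quadI (fun _ => termI_eq_redTerm) locFinite_termI,
    opSum_apply_of_bijOn bijOn_quadII (fun _ => termII_eq_redTerm) locFinite_termII,
    opSum_apply_of_bijOn bijOn_quadIII (fun _ => termIII_eq_redTerm) locFinite_termIII,
    opSum_apply_of_bijOn bijOn_quadIV (fun _ => termIV_eq_redTerm) locFinite_termIV,
    opSum_apply_of_bijOn bijOn_quadV (fun _ => termV_eq_redTerm) locFinite_termV,
    opSum_apply locFinite_redTerm]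
  -- The two prescribed signs locate zero relative to the chain `s < -k < -r < l`: above `l`, below
  -- `s`, between `-k` and `-r`, between `-r` and `l`, between `s` and `-k`, respectively.
  set A := {q | q ∈ redRange ∧ 0 < q.r ∧ q.l < 0}
  set B := {q | q ∈ redRange ∧ q.k < 0 ∧ 0 < q.s}
  set C := {q | q ∈ redRange ∧ q.r < 0 ∧ 0 < q.k}
  set D := {q | q ∈ redRange ∧ 0 < q.r ∧ 0 < q.l}
  set E := {q | q ∈ redRange ∧ q.k < 0 ∧ q.s < 0}
  have hfin : ∀ S ⊆ redRange, (S ∩ Function.support fun q => redTerm q v).Finite :=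
    fun S hS => (locFinite_redTerm v).subset fun q hq => ⟨hS hq.1, hq.2⟩
  have hA : A ⊆ redRange := fun q hq => hq.1
  have hB : B ⊆ redRange := fun q hq => hq.1
  have hC : C ⊆ redRange := fun q hq => hq.1
  have hD : D ⊆ redRange := fun q hq => hq.1
  have hE : E ⊆ redRange := fun q hq => hq.1
  have hunion : redRange = (((A ∪ B) ∪ C) ∪ D) ∪ E := by
    refine Set.Subset.antisymm (fun q hq => ?_)
      (Set.union_subset (Set.union_subset (Set.union_subset (Set.union_subset hA hB) hC) hD) hE)
    obtain ⟨hr, hs, hk, hl, h1, h2, h3, h0⟩ := id hq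
    rcases lt_or_gt_of_ne (halfInt_ne_zero hk) with h | h
    · rcases lt_or_gt_of_ne (halfInt_ne_zero hs) with h' | h'
      · exact Or.inr ⟨hq, h, h'⟩
      · exact Or.inl (Or.inl (Or.inl (Or.inr ⟨hq, h, h'⟩)))
    · rcases lt_or_gt_of_ne (halfInt_ne_zero hr) with h' | h'
      · exact Or.inl (Or.inl (Or.inr ⟨hq, h', h⟩))
      · rcases lt_or_gt_of_ne (halfInt_ne_zero hl) with h'' | h''
        · exact Or.inl (Or.inl (Or.inl (Or.inl ⟨hq, h', h''⟩)))
        · exact Or.inl (Or.inr ⟨hq, h', h''⟩)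
  have d1 : Disjoint A B := by
    rw [Set.disjoint_left]
    rintro q ⟨hq, h1, h2⟩ ⟨-, h3, h4⟩
    have := hq.2.2.2.2.2.2.1
    linarith
  have d2 : Disjoint (A ∪ B) C := by
    rw [Set.disjoint_left]
    rintro q (⟨hq, h1, h2⟩ | ⟨hq, h1, h2⟩) ⟨-, h3, h4⟩ <;> linarith
  have d3 : Disjoint ((A ∪ B) ∪ C) D := by
    rw [Set.disjoint_left]
    rintro q ((⟨hq, h1, h2⟩ | ⟨hq, h1, h2⟩) | ⟨hq, h1, h2⟩) ⟨-, h3, h4⟩ <;>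
      have := hq.2.2.2.2.2.2.1 <;> linarith
  have d4 : Disjoint (((A ∪ B) ∪ C) ∪ D) E := by
    rw [Set.disjoint_left]
    rintro q (((⟨hq, h1, h2⟩ | ⟨hq, h1, h2⟩) | ⟨hq, h1, h2⟩) | ⟨hq, h1, h2⟩) ⟨-, h3, h4⟩ <;>
      have := hq.2.2.2.2.2.2.1 <;> linarith
  have hAB := Set.union_subset hA hB
  have hABC := Set.union_subset hAB hC
  have hABCD := Set.union_subset hABC hD
  rw [hunion, finsum_mem_union' d4 (hfin _ hABCD) (hfin _ hE),
    finsum_mem_union' d3 (hfin _ hABC) (hfin _ hD), finsum_mem_union' d2 (hfin _ hAB) (hfin _ hC),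
    finsum_mem_union' d1 (hfin _ hA) (hfin _ hB)]

/-! ### Maya diagrams -/

/-- The strictly decreasing sequence `λ_i - i - 1` (zero-based). -/
def mayaSeq (lam : YoungDiagram) (i : ℕ) : ℤ := (lam.rowLen i : ℤ) - i - 1

/-- The set of occupied positions of the Maya diagram of a Young diagram. -/
def maya (lam : YoungDiagram) : Set ℤ := Set.range (mayaSeq lam)

theorem mayaSeq_strictAnti (lam : YoungDiagram) : StrictAnti (mayaSeq lam) := by
  refine strictAnti_nat_of_succ_lt fun i => ?_
  have := lam.rowLen_anti i (i + 1) (Nat.le_succ i)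
  simp only [mayaSeq]
  omega

/-- A diagram is closed towards the upper left, so its diagonal cells form an initial segment, and
counting them amounts to finding the first missing one. -/
theorem mem_iff_lt_diagLen (lam : YoungDiagram) (i : ℕ) : (i, i) ∈ lam ↔ i < diagLen lam := by
  have hex : ∃ i, (i, i) ∉ lam := by
    refine ⟨lam.rowLen 0, fun h => ?_⟩
    have := YoungDiagram.mem_iff_lt_rowLen.1 (lam.up_left_mem (Nat.zero_le _) le_rfl h)
    omega
  have key : ∀ i, (i, i) ∈ lam ↔ i < Nat.find hex := fun i => by
    constructor
    · intro h
      by_contra h'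
      exact Nat.find_spec hex (lam.up_left_mem (not_lt.1 h') (not_lt.1 h') h)
    · intro h
      exact not_not.1 (Nat.find_min hex h)
  have hd : diagLen lam = Nat.find hex := by
    have : lam.cells.filter (fun c => c.1 = c.2) =
        (Finset.range (Nat.find hex)).image fun i => (i, i) := by
      ext ⟨i, j⟩
      simp only [Finset.mem_filter, YoungDiagram.mem_cells, Finset.mem_image, Finset.mem_range,
        Prod.mk.injEq]
      constructor
      · rintro ⟨h, rfl⟩
        exact ⟨i, (key i).1 h, rfl, rfl⟩
      · rintro ⟨k, h, rfl, rfl⟩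
        exact ⟨(key k).2 h, rfl⟩
    rw [diagLen, this, Finset.card_image_of_injective _ fun i j h => (Prod.mk.inj h).1,
      Finset.card_range]
  rw [key, hd]

theorem lt_diagLen_iff_rowLen (lam : YoungDiagram) (i : ℕ) :
    i < diagLen lam ↔ i < lam.rowLen i := by
  rw [← mem_iff_lt_diagLen, YoungDiagram.mem_iff_lt_rowLen]

theorem lt_diagLen_iff_colLen (lam : YoungDiagram) (i : ℕ) :
    i < diagLen lam ↔ i < lam.colLen i := by
  rw [← mem_iff_lt_diagLen, YoungDiagram.mem_iff_lt_colLen]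

theorem natCast_mem_maya {lam : YoungDiagram} {n : ℕ} :
    (n : ℤ) ∈ maya lam ↔ ∃ i < diagLen lam, lam.rowLen i - (i + 1) = n := by
  simp only [lt_diagLen_iff_rowLen, maya, Set.mem_range, mayaSeq]
  constructor
  · rintro ⟨i, hi⟩
    exact ⟨i, by omega, by omega⟩
  · rintro ⟨i, hi, h⟩
    exact ⟨i, by omega⟩

/-- An empty site `-m - 1` lies between the particles of rows `i - 1` and `i` for some `i`, and then
column `i - m - 1` has length exactly `i`. Conversely, `rowLen i + colLen j - i - j - 1` is positive
inside the diagram (a hook length) and negative outside, hence never zero, so no particle sits at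
the site of a column mode. -/
theorem neg_natCast_notMem_maya {lam : YoungDiagram} {m : ℕ} :
    -(m : ℤ) - 1 ∉ maya lam ↔ ∃ j < diagLen lam, lam.colLen j - (j + 1) = m := by
  simp only [lt_diagLen_iff_colLen]
  constructor
  · intro hx
    have hex : ∃ i, mayaSeq lam i < -(m : ℤ) - 1 := by
      refine ⟨m + 1 + lam.rowLen 0, ?_⟩
      have := lam.rowLen_anti 0 (m + 1 + lam.rowLen 0) (Nat.zero_le _)
      simp only [mayaSeq]
      omega
    have hlt := Nat.find_spec hex
    have hmin : ∀ i < Nat.find hex, -(m : ℤ) - 1 < mayaSeq lam i := fun i hi =>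
      lt_of_le_of_ne (not_lt.1 (Nat.find_min hex hi)) fun h => hx ⟨i, h.symm⟩
    generalize Nat.find hex = i at hlt hmin
    simp only [mayaSeq] at hlt hmin
    obtain ⟨j, hj⟩ : ∃ j : ℕ, (j : ℤ) = i - m - 1 := ⟨i - m - 1, by omega⟩
    have h1 : ¬ i < lam.colLen j := by
      rw [← YoungDiagram.mem_iff_lt_colLen, YoungDiagram.mem_iff_lt_rowLen]
      omega
    have h2 : i - 1 < lam.colLen j := by
      rw [← YoungDiagram.mem_iff_lt_colLen, YoungDiagram.mem_iff_lt_rowLen]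
      have := hmin (i - 1) (by omega)
      omega
    exact ⟨j, by omega, by omega⟩
  · rintro ⟨j, hj, h⟩ ⟨i, hi⟩
    simp only [mayaSeq] at hi
    by_cases hij : (i, j) ∈ lam
    · have h1 := YoungDiagram.mem_iff_lt_rowLen.1 hij
      have h2 := YoungDiagram.mem_iff_lt_colLen.1 hij
      omega
    · have h1 := mt YoungDiagram.mem_iff_lt_rowLen.2 hij
      have h2 := mt YoungDiagram.mem_iff_lt_colLen.2 hij
      omega

theorem rowMode_eq {lam : YoungDiagram} {i : ℕ} (hi : i < diagLen lam) :
    rowMode lam i = ((lam.rowLen i - (i + 1) : ℕ) : ℚ) + 1 / 2 := by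
  rw [lt_diagLen_iff_rowLen] at hi
  rw [rowMode, Nat.cast_sub (by omega)]
  push_cast
  ring

theorem colMode_eq {lam : YoungDiagram} {i : ℕ} (hi : i < diagLen lam) :
    colMode lam i = ((lam.colLen i - (i + 1) : ℕ) : ℚ) + 1 / 2 := by
  rw [lt_diagLen_iff_colLen] at hi
  rw [colMode, Nat.cast_sub (by omega)]
  push_cast
  ring

theorem mem_rowModes {lam : YoungDiagram} {r : ℚ} :
    r ∈ rowModes lam ↔ ∃ n : ℕ, r = n + 1 / 2 ∧ (n : ℤ) ∈ maya lam := by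
  simp only [rowModes, Finset.mem_image, Finset.mem_range, natCast_mem_maya]
  constructor
  · rintro ⟨i, hi, rfl⟩
    exact ⟨_, rowMode_eq hi, i, hi, rfl⟩
  · rintro ⟨_, rfl, i, hi, rfl⟩
    exact ⟨i, hi, rowMode_eq hi⟩

theorem mem_colModes {lam : YoungDiagram} {r : ℚ} :
    r ∈ colModes lam ↔ ∃ m : ℕ, r = m + 1 / 2 ∧ -(m : ℤ) - 1 ∉ maya lam := by
  simp only [colModes, Finset.mem_image, Finset.mem_range, neg_natCast_notMem_maya]
  constructor
  · rintro ⟨i, hi, rfl⟩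
    exact ⟨_, colMode_eq hi, i, hi, rfl⟩
  · rintro ⟨_, rfl, i, hi, rfl⟩
    exact ⟨i, hi, colMode_eq hi⟩

/-! ### Squeezing and dominance -/

theorem exists_rowLen_eq {f : ℕ → ℕ} (hf : Antitone f) {N : ℕ} (hN : ∀ i, N ≤ i → f i = 0) :
    ∃ mu : YoungDiagram, ∀ i, mu.rowLen i = f i := by
  refine ⟨⟨(Finset.range N ×ˢ Finset.range (f 0)).filter fun c => c.2 < f c.1, ?_⟩, fun i => ?_⟩
  · rintro ⟨i, j⟩ ⟨i', j'⟩ ⟨h1, h2⟩ h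
    simp only at h1 h2
    simp only [Finset.coe_filter, Finset.mem_product, Finset.mem_range, Set.mem_ofPred_eq] at h ⊢
    have := hf h1
    exact ⟨⟨by omega, by omega⟩, by omega⟩
  · refine eq_of_forall_lt_iff fun j => ?_
    rw [← YoungDiagram.mem_iff_lt_rowLen]
    refine Finset.mem_filter.trans ?_
    simp only [Finset.mem_product, Finset.mem_range]
    constructor
    · exact fun h => h.2
    · intro h
      have := hf (Nat.zero_le i)
      refine ⟨⟨?_, by omega⟩, h⟩
      by_contra h'
      have := hN i (not_lt.1 h')
      omega

/-- List `Y` in decreasing order as `h` and take rows `h i + i + 1`. They decrease weakly since `h`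
decreases strictly, and are nonnegative since, counting from zero, the `k`-th smallest of distinct
integers `≥ -N` is at least `-N + k`. -/
theorem image_mayaSeq_of_card {N : ℕ} {Y : Finset ℤ} (hc : Y.card = N)
    (hY : ∀ x ∈ Y, -(N : ℤ) ≤ x) : ∃ mu : YoungDiagram, (∀ i, N ≤ i → mu.rowLen i = 0) ∧
      (Finset.range N).image (mayaSeq mu) = Y := by
  set e := Y.orderEmbOfFin hc
  have he : ∀ k (hk : k < N), -(N : ℤ) + k ≤ e ⟨k, hk⟩ := by
    intro k
    induction k with
    | zero =>
      intro hk
      simpa using hY _ (Y.orderEmbOfFin_mem hc ⟨0, hk⟩)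
    | succ k ih =>
      intro hk
      have h1 := ih (by omega)
      have h2 : e ⟨k, by omega⟩ < e ⟨k + 1, hk⟩ := e.strictMono (Fin.mk_lt_mk.2 (Nat.lt_succ_self k))
      push_cast
      omega
  -- The enumeration `e` increases, hence the reversed index; past `N` the value `-i - 1` encodes an
  -- empty row.
  set h : ℕ → ℤ := fun i => if hi : i < N then e ⟨N - 1 - i, by omega⟩ else -(i : ℤ) - 1 with hh
  have hlt : ∀ i (hi : i < N), h i = e ⟨N - 1 - i, by omega⟩ := fun i hi => dif_pos hi
  have hge : ∀ i, N ≤ i → h i = -(i : ℤ) - 1 := fun i hi => dif_neg (not_lt.2 hi)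
  have hbd : ∀ i : ℕ, -(i : ℤ) - 1 ≤ h i := fun i => by
    rcases lt_or_ge i N with hi | hi
    · rw [hlt i hi]
      have := he (N - 1 - i) (by omega)
      omega
    · rw [hge i hi]
  have hanti : ∀ i, h (i + 1) < h i := fun i => by
    rcases lt_or_ge (i + 1) N with hi | hi
    · rw [hlt _ hi, hlt i (by omega)]
      exact e.strictMono (Fin.mk_lt_mk.2 (by omega))
    · have := hbd i
      rw [hge _ hi]
      push_cast
      omega
  obtain ⟨mu, hmu⟩ := exists_rowLen_eq (f := fun i => (h i + i + 1).toNat) (N := N)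
    (antitone_nat_of_succ_le fun i => by
      have := hanti i
      push_cast
      omega) (fun i hi => by simp only [hge i hi]; omega)
  refine ⟨mu, fun i hi => by rw [hmu, hge i hi]; omega, ?_⟩
  have hseq : mayaSeq mu = h := by
    funext i
    have := hbd i
    simp only [mayaSeq, hmu]
    omega
  ext x
  simp only [hseq, Finset.mem_image, Finset.mem_range]
  constructor
  · rintro ⟨i, hi, rfl⟩
    rw [hlt i hi]
    exact Y.orderEmbOfFin_mem hc _
  · intro hx
    have : x ∈ Set.range e := by
      rw [Finset.range_orderEmbOfFin]
      exact hx
    obtain ⟨⟨k, hk⟩, rfl⟩ := this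
    refine ⟨N - 1 - k, by omega, ?_⟩
    rw [hlt _ (by omega)]
    congr 2
    omega

theorem mem_maya_iff {lam : YoungDiagram} {N : ℕ} (hN : ∀ i, N ≤ i → lam.rowLen i = 0) {x : ℤ} :
    x ∈ maya lam ↔ x ∈ (Finset.range N).image (mayaSeq lam) ∨ x < -(N : ℤ) := by
  simp only [maya, Set.mem_range, Finset.mem_image, Finset.mem_range]
  constructor
  · rintro ⟨i, rfl⟩
    rcases lt_or_ge i N with hi | hi
    · exact Or.inl ⟨i, hi, rfl⟩
    · right
      simp only [mayaSeq, hN i hi]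
      omega
  · rintro (⟨i, -, h⟩ | h)
    · exact ⟨i, h⟩
    · refine ⟨(-x - 1).toNat, ?_⟩
      rw [mayaSeq, hN _ (by omega)]
      omega

theorem card_eq_sum_rowLen {lam : YoungDiagram} {N : ℕ} (hN : ∀ i, N ≤ i → lam.rowLen i = 0) :
    lam.card = ∑ i ∈ Finset.range N, lam.rowLen i := by
  rw [YoungDiagram.card, Finset.card_eq_sum_card_fiberwise (f := Prod.fst) (t := Finset.range N)]
  · exact Finset.sum_congr rfl fun i _ => (lam.rowLen_eq_card).symm
  · rintro ⟨i, j⟩ h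
    have := YoungDiagram.mem_iff_lt_rowLen.1 ((YoungDiagram.mem_cells _).1 h)
    simp only [Finset.coe_range, Set.mem_Iio]
    by_contra h'
    have := hN i (not_lt.1 h')
    omega

theorem sum_rowLen_cast (lam : YoungDiagram) (j : ℕ) :
    ((∑ i ∈ Finset.range j, lam.rowLen i : ℕ) : ℤ) =
      ∑ i ∈ Finset.range j, mayaSeq lam i + ∑ i ∈ Finset.range j, ((i : ℤ) + 1) := by
  rw [← Finset.sum_add_distrib]
  push_cast
  exact Finset.sum_congr rfl fun i _ => by rw [mayaSeq]; ring

/-- Take as threshold `t` the `j`-th entry of `lam`. For `lam` the truncated sum is then exactly the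
sum of the first `j` entries minus `t`, while for `mu` it bounds the corresponding sum from above.
-/
theorem sum_mayaSeq_le {lam mu : YoungDiagram} {N : ℕ}
    (h : ∀ t : ℤ, ∑ i ∈ Finset.range N, max (mayaSeq mu i - t) 0 ≤
      ∑ i ∈ Finset.range N, max (mayaSeq lam i - t) 0) {j : ℕ} (hj : j ≤ N) :
    ∑ i ∈ Finset.range j, mayaSeq mu i ≤ ∑ i ∈ Finset.range j, mayaSeq lam i := by
  set t := mayaSeq lam j with ht
  have hsub : Finset.range j ⊆ Finset.range N := Finset.range_subset_range.2 hj
  have h1 : ∑ i ∈ Finset.range j, (mayaSeq mu i - t) ≤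
      ∑ i ∈ Finset.range N, max (mayaSeq mu i - t) 0 :=
    (Finset.sum_le_sum fun i _ => le_max_left _ _).trans
      (Finset.sum_le_sum_of_subset_of_nonneg hsub fun i _ _ => le_max_right _ _)
  have h2 : ∑ i ∈ Finset.range N, max (mayaSeq lam i - t) 0 =
      ∑ i ∈ Finset.range j, (mayaSeq lam i - t) := by
    rw [← Finset.sum_subset hsub]
    · refine Finset.sum_congr rfl fun i hi => max_eq_left ?_
      have := mayaSeq_strictAnti lam (Finset.mem_range.1 hi)
      omega
    · intro i _ hi
      have := (mayaSeq_strictAnti lam).antitone (not_lt.1 (mt Finset.mem_range.2 hi))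
      exact max_eq_right (by omega)
  have h3 := h1.trans ((h t).trans h2.le)
  simpa [Finset.sum_sub_distrib] using h3

/-- A sum of `φ` over the particles changes by `φ a' + φ b' - φ a - φ b`. With `φ` constant this
counts particles, with `φ` the identity it gives the number of boxes, and with `φ` convex it gives
dominance. -/
theorem exists_squeeze {lam : YoungDiagram} {a b a' b' : ℤ} (ha : a ∈ maya lam)
    (hb : b ∈ maya lam) (ha' : a' ∉ maya lam) (hb' : b' ∉ maya lam) (hsum : a + b = a' + b')
    (h1 : b < a') (h2 : a' < a) (hne : a' ≠ b') :
    ∃ mu : YoungDiagram, StrictlyBelow mu lam ∧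
      ∀ x, x ∈ maya mu ↔ (x ∈ maya lam ∧ x ≠ a ∧ x ≠ b) ∨ x = a' ∨ x = b' := by
  -- `N` bounds both the number of rows and the depth of the move, so all four sites lie above the
  -- completely filled region below `-N`.
  obtain ⟨N, hN, hbN⟩ : ∃ N : ℕ, (∀ i, N ≤ i → lam.rowLen i = 0) ∧ -(N : ℤ) ≤ b := by
    refine ⟨max (lam.colLen 0) (-b).toNat, fun i hi => ?_, by omega⟩
    have : ¬ i < lam.colLen 0 := by omega
    rw [← YoungDiagram.mem_iff_lt_colLen, YoungDiagram.mem_iff_lt_rowLen] at this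
    omega
  set Y := (Finset.range N).image (mayaSeq lam) with hY
  have hmaya : ∀ x, x ∈ maya lam ↔ x ∈ Y ∨ x < -(N : ℤ) := fun x => mem_maya_iff hN
  have hYN : ∀ x ∈ Y, -(N : ℤ) ≤ x := by
    intro x hx
    obtain ⟨i, hi, rfl⟩ := Finset.mem_image.1 hx
    have := Finset.mem_range.1 hi
    simp only [mayaSeq]
    omega
  have haY : a ∈ Y := ((hmaya a).1 ha).resolve_right (by omega)
  have hbY : b ∈ Y := ((hmaya b).1 hb).resolve_right (by omega)
  have haY' : a' ∉ Y := fun h => ha' ((hmaya a').2 (Or.inl h))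
  have hbY' : b' ∉ Y := fun h => hb' ((hmaya b').2 (Or.inl h))
  have hbe : b ∈ Y.erase a := Finset.mem_erase.2 ⟨by omega, hbY⟩
  have hn1 : b' ∉ (Y.erase a).erase b := fun h =>
    hbY' (Finset.mem_of_mem_erase (Finset.mem_of_mem_erase h))
  have hn2 : a' ∉ insert b' ((Y.erase a).erase b) := fun h => by
    rcases Finset.mem_insert.1 h with h | h
    · exact hne h
    · exact haY' (Finset.mem_of_mem_erase (Finset.mem_of_mem_erase h))
  set Y' := insert a' (insert b' ((Y.erase a).erase b)) with hY'
  have hsumY : ∀ φ : ℤ → ℤ, ∑ x ∈ Y', φ x + φ a + φ b = ∑ x ∈ Y, φ x + φ a' + φ b' := fun φ => by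
    rw [hY', Finset.sum_insert hn2, Finset.sum_insert hn1, ← Finset.add_sum_erase Y φ haY,
      ← Finset.add_sum_erase _ φ hbe]
    ring
  have hcardY : Y.card = N := by
    rw [hY, Finset.card_image_of_injective _ (mayaSeq_strictAnti lam).injective, Finset.card_range]
  have hcard : Y'.card = N := by
    have := hsumY fun _ => 1
    simp only [Finset.sum_const, mul_one, nsmul_eq_mul] at this
    omega
  have hYN' : ∀ x ∈ Y', -(N : ℤ) ≤ x := by
    intro x hx
    simp only [hY', Finset.mem_insert, Finset.mem_erase] at hx
    rcases hx with rfl | rfl | ⟨-, -, hx⟩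
    · omega
    · omega
    · exact hYN x hx
  obtain ⟨mu, hmuN, hmu⟩ := image_mayaSeq_of_card hcard hYN'
  have hmem : ∀ x, x ∈ maya mu ↔ (x ∈ maya lam ∧ x ≠ a ∧ x ≠ b) ∨ x = a' ∨ x = b' := by
    intro x
    rw [mem_maya_iff hmuN, hmu, hmaya]
    simp only [hY', Finset.mem_insert, Finset.mem_erase]
    constructor
    · rintro ((rfl | rfl | ⟨h3, h4, h5⟩) | h3)
      · exact Or.inr (Or.inl rfl)
      · exact Or.inr (Or.inr rfl)
      · exact Or.inl ⟨Or.inl h5, h4, h3⟩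
      · exact Or.inl ⟨Or.inr h3, by omega, by omega⟩
    · rintro (⟨h3 | h3, h4, h5⟩ | rfl | rfl)
      · exact Or.inl (Or.inr (Or.inr ⟨h5, h4, h3⟩))
      · exact Or.inr h3
      · exact Or.inl (Or.inl rfl)
      · exact Or.inl (Or.inr (Or.inl rfl))
  have htrans : ∀ φ : ℤ → ℤ, ∑ i ∈ Finset.range N, φ (mayaSeq mu i) + φ a + φ b =
      ∑ i ∈ Finset.range N, φ (mayaSeq lam i) + φ a' + φ b' := fun φ => by
    have := hsumY φ
    rwa [← hmu, hY, Finset.sum_image (mayaSeq_strictAnti mu).injective.injOn,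
      Finset.sum_image (mayaSeq_strictAnti lam).injective.injOn] at this
  -- Convexity: the pair `a'`, `b'` lies strictly between `b` and `a` and has the same sum.
  have hmax : ∀ t : ℤ, ∑ i ∈ Finset.range N, max (mayaSeq mu i - t) 0 ≤
      ∑ i ∈ Finset.range N, max (mayaSeq lam i - t) 0 := fun t => by
    have := htrans fun x => max (x - t) 0
    omega
  have hmin : ∀ nu : YoungDiagram, (∀ i, N ≤ i → nu.rowLen i = 0) → ∀ j,
      ∑ i ∈ Finset.range j, nu.rowLen i = ∑ i ∈ Finset.range (min j N), nu.rowLen i := by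
    intro nu hnu j
    refine (Finset.sum_subset (Finset.range_subset_range.2 (min_le_left _ _)) fun i hi hi' => ?_).symm
    rw [Finset.mem_range] at hi hi'
    exact hnu i (by omega)
  refine ⟨mu, ⟨?_, fun j => ?_, ?_⟩, hmem⟩
  · rw [card_eq_sum_rowLen hN, card_eq_sum_rowLen hmuN]
    have h3 := htrans fun x => x
    have h4 := sum_rowLen_cast mu N
    have h5 := sum_rowLen_cast lam N
    omega
  · rw [hmin mu hmuN j, hmin lam hN j]
    have h3 := sum_mayaSeq_le hmax (min_le_right j N)
    have h4 := sum_rowLen_cast mu (min j N)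
    have h5 := sum_rowLen_cast lam (min j N)
    omega
  · rintro rfl
    exact ha' ((hmem a').2 (Or.inr (Or.inl rfl)))

/-! ### Monomials -/

/-- The exterior monomial of a list of modes. -/
noncomputable def mono (L : List (ℕ ⊕ ℕ)) : Fock :=
  (L.map fun i => ExteriorAlgebra.ι ℂ (Finsupp.single i (1 : ℂ))).prod

theorem mono_cons (i : ℕ ⊕ ℕ) (L : List (ℕ ⊕ ℕ)) : mono (i :: L) = create i (mono L) := by
  simp [mono, create]

theorem create_create (i j : ℕ ⊕ ℕ) (v : Fock) :
    create i (create j v) = -create j (create i v) :=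
  LinearMap.congr_fun (create_mul_create i j) v

theorem create_self (i : ℕ ⊕ ℕ) (v : Fock) : create i (create i v) = 0 := by
  simp only [create, LinearMap.mulLeft_apply, ← mul_assoc, ExteriorAlgebra.ι_sq_zero, zero_mul]

theorem annihilate_create (i j : ℕ ⊕ ℕ) (v : Fock) :
    annihilate i (create j v) = (if i = j then v else 0) - create j (annihilate i v) := by
  refine (annihilate_ι_mul i (Finsupp.single j 1) v).trans ?_
  rw [Finsupp.single_apply, create, LinearMap.mulLeft_apply]
  by_cases h : i = j
  · simp [h]
  · simp [h, Ne.symm h]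

theorem create_mono_of_mem {i : ℕ ⊕ ℕ} {L : List (ℕ ⊕ ℕ)} (h : i ∈ L) : create i (mono L) = 0 := by
  induction L with
  | nil => simp at h
  | cons j L ih =>
    rw [mono_cons]
    rcases List.mem_cons.1 h with rfl | h
    · exact create_self _ _
    · rw [create_create, ih h, map_zero, neg_zero]

theorem annihilate_mono_of_notMem {i : ℕ ⊕ ℕ} {L : List (ℕ ⊕ ℕ)} (h : i ∉ L) :
    annihilate i (mono L) = 0 := by
  induction L with
  | nil =>
    have : mono [] = algebraMap ℂ Fock 1 := by simp [mono]
    rw [this, annihilate_algebraMap]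
  | cons j L ih =>
    rw [List.mem_cons, not_or] at h
    rw [mono_cons, annihilate_create, if_neg h.1, ih h.2, map_zero, sub_zero]

theorem mono_perm {L L' : List (ℕ ⊕ ℕ)} (h : L.Perm L') : mono L = mono L' ∨ mono L = -mono L' := by
  induction h with
  | nil => exact Or.inl rfl
  | cons i _ ih =>
    rw [mono_cons, mono_cons]
    rcases ih with h | h
    · exact Or.inl (by rw [h])
    · exact Or.inr (by rw [h, map_neg])
  | swap i j L =>
    right
    rw [mono_cons, mono_cons, mono_cons, mono_cons, create_create]
  | trans _ _ ih1 ih2 =>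
    rcases ih1 with h1 | h1 <;> rcases ih2 with h2 | h2
    · exact Or.inl (h1.trans h2)
    · exact Or.inr (h1.trans h2)
    · exact Or.inr (by rw [h1, h2])
    · exact Or.inl (by rw [h1, h2, neg_neg])

/-- `v` is, up to sign, the monomial of the set `S` of modes. -/
def IsMono (S : Finset (ℕ ⊕ ℕ)) (v : Fock) : Prop :=
  ∃ L : List (ℕ ⊕ ℕ), L.Nodup ∧ L.toFinset = S ∧ (v = mono L ∨ v = -mono L)

theorem IsMono.neg {S : Finset (ℕ ⊕ ℕ)} {v : Fock} : IsMono S v → IsMono S (-v) := by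
  rintro ⟨L, hL, hS, h | h⟩
  · exact ⟨L, hL, hS, Or.inr (by rw [h])⟩
  · exact ⟨L, hL, hS, Or.inl (by rw [h, neg_neg])⟩

theorem isMono_empty : IsMono ∅ vac := ⟨[], List.nodup_nil, rfl, Or.inl (by simp [mono, vac])⟩

theorem IsMono.eq_or_eq_neg {S : Finset (ℕ ⊕ ℕ)} {v w : Fock} :
    IsMono S v → IsMono S w → v = w ∨ v = -w := by
  rintro ⟨L, hL, hS, h⟩ ⟨L', hL', hS', h'⟩
  have hp := mono_perm (List.perm_of_nodup_nodup_toFinset_eq hL hL' (hS.trans hS'.symm))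
  rcases h with rfl | rfl <;> rcases h' with rfl | rfl <;> simpa [neg_eq_iff_eq_neg, or_comm] using hp

theorem IsMono.create {S : Finset (ℕ ⊕ ℕ)} {v : Fock} (hv : IsMono S v) (i : ℕ ⊕ ℕ) :
    create i v = 0 ∨ i ∉ S ∧ IsMono (insert i S) (create i v) := by
  obtain ⟨L, hL, hS, h⟩ := hv
  by_cases hi : i ∈ L
  · left
    rcases h with rfl | rfl
    · exact create_mono_of_mem hi
    · rw [map_neg, create_mono_of_mem hi, neg_zero]
  · right
    refine ⟨by rwa [← hS, List.mem_toFinset], i :: L, List.nodup_cons.2 ⟨hi, hL⟩, by simp [hS], ?_⟩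
    rcases h with rfl | rfl
    · exact Or.inl (mono_cons i L).symm
    · exact Or.inr (by rw [map_neg, mono_cons])

theorem IsMono.annihilate {S : Finset (ℕ ⊕ ℕ)} {v : Fock} (hv : IsMono S v) (i : ℕ ⊕ ℕ) :
    annihilate i v = 0 ∨ i ∈ S ∧ IsMono (S.erase i) (annihilate i v) := by
  obtain ⟨L, hL, hS, h⟩ := hv
  by_cases hi : i ∈ L
  · right
    obtain ⟨s, t, hst⟩ := List.append_of_mem hi
    have hp : L.Perm (i :: (s ++ t)) := hst ▸ List.perm_middle
    have hn := List.nodup_cons.1 (hp.nodup_iff.1 hL)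
    have e : CSFermion.annihilate i (mono (i :: (s ++ t))) = mono (s ++ t) := by
      rw [mono_cons, annihilate_create, if_pos rfl, annihilate_mono_of_notMem hn.1, map_zero,
        sub_zero]
    refine ⟨by rwa [← hS, List.mem_toFinset], s ++ t, hn.2, ?_, ?_⟩
    · rw [← hS, List.toFinset_eq_of_perm _ _ hp, List.toFinset_cons, Finset.erase_insert]
      rw [List.mem_toFinset]
      exact hn.1
    · rw [← e]
      rcases h with rfl | rfl <;> rcases mono_perm hp with h | h <;> simp [h]
  · left
    rcases h with rfl | rfl
    · exact annihilate_mono_of_notMem hi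
    · rw [map_neg, annihilate_mono_of_notMem hi, neg_zero]

/-! ### Occupation sets -/

/-- `v` is, up to sign, the monomial whose set of occupied positions is `P`. -/
def HasOccupation (P : Set ℤ) (v : Fock) : Prop :=
  ∃ S, IsMono S v ∧ (∀ n : ℕ, Sum.inl n ∈ S ↔ (n : ℤ) ∈ P) ∧
    ∀ m : ℕ, Sum.inr m ∈ S ↔ -(m : ℤ) - 1 ∉ P

theorem HasOccupation.eq_or_eq_neg {P : Set ℤ} {v w : Fock} :
    HasOccupation P v → HasOccupation P w → v = w ∨ v = -w := by
  rintro ⟨S, hS, h1, h2⟩ ⟨S', hS', h1', h2'⟩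
  have : S = S' := by
    ext (n | m)
    · rw [h1, h1']
    · rw [h2, h2']
  subst this
  exact hS.eq_or_eq_neg hS'

theorem floor_natCast_add_half (n : ℕ) : ⌊(n : ℚ) + 1 / 2⌋₊ = n := by
  rw [Nat.floor_eq_iff (by positivity)]
  constructor <;> linarith

theorem psi_neg_natCast (n : ℕ) : psi (-((n : ℚ) + 1 / 2)) = create (Sum.inl n) := by
  have h : (0 : ℚ) < n + 1 / 2 := by positivity
  rw [psi, if_neg (by linarith), abs_neg, abs_of_pos h, floor_natCast_add_half]

theorem psiStar_neg_natCast (n : ℕ) : psiStar (-((n : ℚ) + 1 / 2)) = create (Sum.inr n) := by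
  have h : (0 : ℚ) < n + 1 / 2 := by positivity
  rw [psiStar, if_neg (by linarith), abs_neg, abs_of_pos h, floor_natCast_add_half]

theorem psi_natCast (n : ℕ) : psi ((n : ℚ) + 1 / 2) = annihilate (Sum.inr n) := by
  have h : (0 : ℚ) < n + 1 / 2 := by positivity
  rw [psi, if_pos h, abs_of_pos h, floor_natCast_add_half]

theorem psiStar_natCast (n : ℕ) : psiStar ((n : ℚ) + 1 / 2) = annihilate (Sum.inl n) := by
  have h : (0 : ℚ) < n + 1 / 2 := by positivity
  rw [psiStar, if_pos h, abs_of_pos h, floor_natCast_add_half]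

theorem exists_nat_or (x : ℤ) : (∃ n : ℕ, x = n) ∨ ∃ m : ℕ, x = -m - 1 := by
  rcases le_or_gt 0 x with h | h
  · exact Or.inl ⟨x.toNat, by omega⟩
  · exact Or.inr ⟨(-x - 1).toNat, by omega⟩

/-- For `x ≥ 0` the mode creates a particle, for `x < 0` it annihilates a hole; either way the site
`x` gets filled. This makes the five families uniform. -/
theorem HasOccupation.psi {P : Set ℤ} {v : Fock} (hv : HasOccupation P v) (x : ℤ) {r : ℚ}
    (hr : r = -((x : ℚ) + 1 / 2)) :
    psi r v = 0 ∨ x ∉ P ∧ HasOccupation (insert x P) (psi r v) := by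
  obtain ⟨S, hS, h1, h2⟩ := hv
  subst hr
  rcases exists_nat_or x with ⟨n, rfl⟩ | ⟨m, rfl⟩
  · rw [Int.cast_natCast, psi_neg_natCast]
    refine (hS.create (Sum.inl n)).imp_right fun h => ⟨(h1 n).not.1 h.1, _, h.2, ?_, ?_⟩
    · intro n'
      rw [Finset.mem_insert, Set.mem_insert_iff, h1, Sum.inl.injEq, Nat.cast_inj]
    · intro m'
      rw [Finset.mem_insert, Set.mem_insert_iff, h2, not_or]
      simp only [reduceCtorEq, false_or, iff_and_self]
      omega
  · have e : -(((-(m : ℤ) - 1 : ℤ) : ℚ) + 1 / 2) = m + 1 / 2 := by push_cast; ring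
    rw [e, psi_natCast]
    refine (hS.annihilate (Sum.inr m)).imp_right fun h => ⟨(h2 m).1 h.1, _, h.2, ?_, ?_⟩
    · intro n'
      rw [Finset.mem_erase, Set.mem_insert_iff, h1]
      have : ¬ (n' : ℤ) = -m - 1 := by omega
      simp [this]
    · intro m'
      rw [Finset.mem_erase, Set.mem_insert_iff, h2, not_or, ne_eq, Sum.inr.injEq]
      have : -(m' : ℤ) - 1 = -m - 1 ↔ m' = m := by omega
      rw [this]

theorem HasOccupation.psiStar {P : Set ℤ} {v : Fock} (hv : HasOccupation P v) (x : ℤ) {r : ℚ}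
    (hr : r = (x : ℚ) + 1 / 2) :
    psiStar r v = 0 ∨ x ∈ P ∧ HasOccupation (P \ {x}) (psiStar r v) := by
  obtain ⟨S, hS, h1, h2⟩ := hv
  subst hr
  rcases exists_nat_or x with ⟨n, rfl⟩ | ⟨m, rfl⟩
  · rw [Int.cast_natCast, psiStar_natCast]
    refine (hS.annihilate (Sum.inl n)).imp_right fun h => ⟨(h1 n).1 h.1, _, h.2, ?_, ?_⟩
    · intro n'
      rw [Finset.mem_erase, Set.mem_sdiff, Set.mem_singleton_iff, h1, ne_eq, Sum.inl.injEq,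
        Nat.cast_inj, and_comm]
    · intro m'
      have : ¬ -(m' : ℤ) - 1 = n := by omega
      rw [Finset.mem_erase, Set.mem_sdiff, h2]
      simp [this]
  · have e : ((-(m : ℤ) - 1 : ℤ) : ℚ) + 1 / 2 = -(m + 1 / 2) := by push_cast; ring
    rw [e, psiStar_neg_natCast]
    refine (hS.create (Sum.inr m)).imp_right fun h =>
      ⟨not_not.1 ((h2 m).not.1 h.1), _, h.2, ?_, ?_⟩
    · intro n'
      have : ¬ (n' : ℤ) = -m - 1 := by omega
      rw [Finset.mem_insert, Set.mem_sdiff, h1]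
      simp [this]
    · intro m'
      have : -(m' : ℤ) - 1 = -m - 1 ↔ m' = m := by omega
      rw [Finset.mem_insert, Set.mem_sdiff, Set.mem_singleton_iff, h2, Sum.inr.injEq, this]
      tauto

theorem isMono_prod {f g : ℕ → ℕ} {d : ℕ} (hf : Set.InjOn f (Set.Iio d))
    (hg : Set.InjOn g (Set.Iio d)) (I : List ℕ) (hI : I.Nodup) (hd : ∀ i ∈ I, i < d) :
    IsMono ((I.toFinset.image f).disjSum (I.toFinset.image g))
      ((I.map fun i => create (Sum.inl (f i)) * create (Sum.inr (g i))).prod vac) := by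
  induction I with
  | nil => simpa using isMono_empty
  | cons i I ih =>
    rw [List.nodup_cons] at hI
    rw [List.forall_mem_cons] at hd
    have h := ih hI.2 hd.2
    obtain ⟨L, hL, hS, hv⟩ := h
    have hn1 : Sum.inr (g i) ∉ L := by
      rw [← List.mem_toFinset, hS]
      simp only [Finset.inr_mem_disjSum, Finset.mem_image, List.mem_toFinset, not_exists, not_and]
      intro j hj e
      exact hI.1 (hg (hd.2 j hj) hd.1 e ▸ hj)
    have hn2 : Sum.inl (f i) ∉ Sum.inr (g i) :: L := by
      rw [List.mem_cons, ← List.mem_toFinset, hS]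
      simp only [reduceCtorEq, false_or, Finset.inl_mem_disjSum, Finset.mem_image,
        List.mem_toFinset, not_exists, not_and]
      intro j hj e
      exact hI.1 (hf (hd.2 j hj) hd.1 e ▸ hj)
    refine ⟨Sum.inl (f i) :: Sum.inr (g i) :: L,
      List.nodup_cons.2 ⟨hn2, List.nodup_cons.2 ⟨hn1, hL⟩⟩, ?_, ?_⟩
    · rw [List.toFinset_cons, List.toFinset_cons, hS]
      ext (n | m) <;> simp
    · rw [List.map_cons, List.prod_cons, Module.End.mul_apply, Module.End.mul_apply, mono_cons,
        mono_cons]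
      rcases hv with h | h <;> rw [h] <;> simp

/-- The row modes are distinct, and so are the column modes, so the product is a genuine monomial;
the prefactor only affects its sign. -/
theorem hasOccupation_schurState (lam : YoungDiagram) :
    HasOccupation (maya lam) (schurState lam) := by
  have hf : Set.InjOn (fun i => lam.rowLen i - (i + 1)) (Set.Iio (diagLen lam)) := by
    intro i hi j hj h
    rw [Set.mem_Iio, lt_diagLen_iff_rowLen] at hi hj
    refine (mayaSeq_strictAnti lam).injective ?_
    simp only [mayaSeq] at h ⊢
    omega
  have hg : Set.InjOn (fun i => lam.colLen i - (i + 1)) (Set.Iio (diagLen lam)) := by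
    intro i hi j hj h
    rw [Set.mem_Iio, lt_diagLen_iff_colLen] at hi hj
    simp only at h
    rcases le_total i j with hij | hij
    · have := lam.colLen_anti i j hij
      omega
    · have := lam.colLen_anti j i hij
      omega
  have h := isMono_prod hf hg (List.range (diagLen lam)) List.nodup_range
    fun i hi => List.mem_range.1 hi
  have e : ((List.range (diagLen lam)).map
      fun i => psi (-rowMode lam i) * psiStar (-colMode lam i)) =
      (List.range (diagLen lam)).map fun i => create (Sum.inl (lam.rowLen i - (i + 1))) *
        create (Sum.inr (lam.colLen i - (i + 1))) := by
    refine List.map_congr_left fun i hi => ?_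
    rw [rowMode_eq (List.mem_range.1 hi), colMode_eq (List.mem_range.1 hi), psi_neg_natCast,
      psiStar_neg_natCast]
  refine ⟨((List.range (diagLen lam)).toFinset.image fun i => lam.rowLen i - (i + 1)).disjSum
    ((List.range (diagLen lam)).toFinset.image fun i => lam.colLen i - (i + 1)),
    ?_, fun n => ?_, fun m => ?_⟩
  · rw [schurState, e]
    rcases neg_one_pow_eq_or ℂ
      (∑ i ∈ Finset.range (diagLen lam), (lam.colLen i - (i + 1))) with h' | h' <;> rw [h']
    · rw [one_smul]
      exact h
    · rw [neg_smul, one_smul]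
      exact h.neg
  · simp [natCast_mem_maya]
  · simp [neg_natCast_notMem_maya]

/-! ### The five processes -/

theorem intCast_mem_rowModes {lam : YoungDiagram} {x : ℤ} :
    (x : ℚ) + 1 / 2 ∈ rowModes lam ↔ 0 ≤ x ∧ x ∈ maya lam := by
  rw [mem_rowModes]
  constructor
  · rintro ⟨n, h, hn⟩
    have : x = n := by
      have : (x : ℚ) = (n : ℤ) := by push_cast; linarith
      exact_mod_cast this
    subst this
    exact ⟨by omega, hn⟩
  · rintro ⟨h0, h⟩
    lift x to ℕ using h0
    exact ⟨x, by simp, h⟩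

theorem intCast_mem_colModes {lam : YoungDiagram} {x : ℤ} :
    (x : ℚ) + 1 / 2 ∈ colModes lam ↔ 0 ≤ x ∧ -x - 1 ∉ maya lam := by
  rw [mem_colModes]
  constructor
  · rintro ⟨n, h, hn⟩
    have : x = n := by
      have : (x : ℚ) = (n : ℤ) := by push_cast; linarith
      exact_mod_cast this
    subst this
    exact ⟨by omega, hn⟩
  · rintro ⟨h0, h⟩
    lift x to ℕ using h0
    exact ⟨x, by simp, h⟩

/-- The half-integers `x + 1/2` for `x` in a finite set of integers. -/
def shiftHalf (A : Finset ℤ) : Finset ℚ := A.image fun x : ℤ => (x : ℚ) + 1 / 2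

theorem mem_shiftHalf {A : Finset ℤ} {x : ℤ} : (x : ℚ) + 1 / 2 ∈ shiftHalf A ↔ x ∈ A := by
  simp [shiftHalf]

theorem finset_ext_halfInt {F G : Finset ℚ} (hF : ∀ r ∈ F, r ∈ HalfInt) (hG : ∀ r ∈ G, r ∈ HalfInt)
    (h : ∀ x : ℤ, (x : ℚ) + 1 / 2 ∈ F ↔ (x : ℚ) + 1 / 2 ∈ G) : F = G := by
  ext r
  constructor
  · intro hr
    obtain ⟨x, rfl⟩ := hF r hr
    exact (h x).1 hr
  · intro hr
    obtain ⟨x, rfl⟩ := hG r hr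
    exact (h x).2 hr

theorem halfInt_of_mem_rowModes {lam : YoungDiagram} {r : ℚ} (h : r ∈ rowModes lam) :
    r ∈ HalfInt := by
  obtain ⟨n, rfl, -⟩ := mem_rowModes.1 h
  exact ⟨n, by simp⟩

theorem halfInt_of_mem_colModes {lam : YoungDiagram} {r : ℚ} (h : r ∈ colModes lam) :
    r ∈ HalfInt := by
  obtain ⟨n, rfl, -⟩ := mem_colModes.1 h
  exact ⟨n, by simp⟩

theorem halfInt_of_mem_shiftHalf {A : Finset ℤ} {r : ℚ} (h : r ∈ shiftHalf A) : r ∈ HalfInt := by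
  obtain ⟨n, -, rfl⟩ := Finset.mem_image.1 h
  exact ⟨n, rfl⟩

/-- The common core of the five families. A nonnegative site is a row mode when occupied; a negative
site `-x - 1` is the column mode `x + 1/2` when empty. So filling a negative site deletes a column
mode and emptying one adds it, which is what `A`, `B`, `A'`, `B'` record. -/
theorem isSqueezing_of_occupation {T : Module.End ℂ Fock} {A B A' B' : Finset ℤ} {a b a' b' : ℤ}
    (hsum : a + b = a' + b') (h1 : b < a') (h2 : a' < a) (hne : a' ≠ b')
    (hA : ∀ x, x ∈ A ↔ 0 ≤ x ∧ (x = a ∨ x = b)) (hB : ∀ x, x ∈ B ↔ 0 ≤ x ∧ (-x - 1 = a' ∨ -x - 1 = b'))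
    (hA' : ∀ x, x ∈ A' ↔ 0 ≤ x ∧ (x = a' ∨ x = b'))
    (hB' : ∀ x, x ∈ B' ↔ 0 ≤ x ∧ (-x - 1 = a ∨ -x - 1 = b))
    (hT : ∀ lam : YoungDiagram, T (schurState lam) = 0 ∨
      (a ∈ maya lam ∧ b ∈ maya lam ∧ a' ∉ maya lam ∧ b' ∉ maya lam ∧
        HasOccupation ((maya lam \ {a, b}) ∪ {a', b'}) (T (schurState lam)))) :
    IsSqueezing T (shiftHalf A) (shiftHalf B) (shiftHalf A') (shiftHalf B') := by
  intro lam
  refine (hT lam).imp_right ?_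
  rintro ⟨ha, hb, ha', hb', hocc⟩
  obtain ⟨mu, hmu, hmem⟩ := exists_squeeze ha hb ha' hb' hsum h1 h2 hne
  have hset : maya mu = (maya lam \ {a, b}) ∪ {a', b'} := by
    ext x
    rw [hmem]
    simp only [Set.mem_union, Set.mem_sdiff, Set.mem_insert_iff, Set.mem_singleton_iff, not_or]
  refine ⟨mu, hmu, ?_, ?_, ?_, ?_, hocc.eq_or_eq_neg (hset ▸ hasOccupation_schurState mu)⟩
  · intro r hr
    obtain ⟨x, hx, rfl⟩ := Finset.mem_image.1 hr
    obtain ⟨h0, rfl | rfl⟩ := (hA x).1 hx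
    · exact intCast_mem_rowModes.2 ⟨h0, ha⟩
    · exact intCast_mem_rowModes.2 ⟨h0, hb⟩
  · intro r hr
    obtain ⟨x, hx, rfl⟩ := Finset.mem_image.1 hr
    obtain ⟨h0, h | h⟩ := (hB x).1 hx
    · exact intCast_mem_colModes.2 ⟨h0, h ▸ ha'⟩
    · exact intCast_mem_colModes.2 ⟨h0, h ▸ hb'⟩
  · refine finset_ext_halfInt (fun r => halfInt_of_mem_rowModes) (fun r hr => ?_) fun x => ?_
    · rcases Finset.mem_union.1 hr with hr | hr
      · exact halfInt_of_mem_rowModes (Finset.mem_sdiff.1 hr).1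
      · exact halfInt_of_mem_shiftHalf hr
    · rw [Finset.mem_union, Finset.mem_sdiff, intCast_mem_rowModes, intCast_mem_rowModes,
        mem_shiftHalf, mem_shiftHalf, hA, hA', hmem]
      tauto
  · refine finset_ext_halfInt (fun r => halfInt_of_mem_colModes) (fun r hr => ?_) fun x => ?_
    · rcases Finset.mem_union.1 hr with hr | hr
      · exact halfInt_of_mem_colModes (Finset.mem_sdiff.1 hr).1
      · exact halfInt_of_mem_shiftHalf hr
    · rw [Finset.mem_union, Finset.mem_sdiff, intCast_mem_colModes, intCast_mem_colModes,
        mem_shiftHalf, mem_shiftHalf, hB, hB', hmem]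
      -- The emptied sites differ from the filled ones, so a newly made hole is not filled again.
      have e1 : -x - 1 = a → -x - 1 ≠ a' ∧ -x - 1 ≠ b' := by omega
      have e2 : -x - 1 = b → -x - 1 ≠ a' ∧ -x - 1 ≠ b' := by omega
      tauto

theorem shiftHalf_empty : shiftHalf ∅ = ∅ := rfl

theorem shiftHalf_singleton (x : ℤ) : shiftHalf {x} = {(x : ℚ) + 1 / 2} :=
  Finset.image_singleton _ _

theorem shiftHalf_pair (x y : ℤ) : shiftHalf {x, y} = {(x : ℚ) + 1 / 2, (y : ℚ) + 1 / 2} := by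
  rw [shiftHalf, Finset.image_insert, Finset.image_singleton]

theorem nonneg_of_half_pos {x : ℤ} (h : (0 : ℚ) < x + 1 / 2) : 0 ≤ x := by
  have : ((-1 : ℤ) : ℚ) < x := by push_cast; linarith
  have : -1 < x := by exact_mod_cast this
  omega

theorem lt_of_add_half_lt {x y : ℤ} (h : (x : ℚ) + 1 / 2 < y + 1 / 2) : x < y := by
  have : (x : ℚ) < y := by linarith
  exact_mod_cast this

theorem natCast_le_of_le_half {x : ℤ} {n : ℕ} (h : (n : ℚ) ≤ x + 1 / 2 - 1 / 2) : (n : ℤ) ≤ x := by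
  have : ((n : ℤ) : ℚ) ≤ x := by push_cast; linarith
  exact_mod_cast this

theorem isSqueezing_procI {p : ParamN} (hp : p ∈ rangeI) :
    IsSqueezing (procI p) ∅ {p.r, p.k} ∅ {p.k + p.n, p.r - p.n} := by
  obtain ⟨k, r, n⟩ := p
  obtain ⟨⟨k, rfl⟩, ⟨r, rfl⟩, h1, h2, h3, h4⟩ := hp
  simp only at h1 h2 h3 h4
  replace h1 := nonneg_of_half_pos h1
  replace h2 := lt_of_add_half_lt h2
  replace h4 := natCast_le_of_le_half h4
  -- From here `k` and `r` are integers, labelling the modes `k + 1/2` and `r + 1/2`.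
  suffices h : IsSqueezing (procI ⟨k + 1 / 2, r + 1 / 2, n⟩)
      (shiftHalf ∅) (shiftHalf {r, k})
      (shiftHalf ∅) (shiftHalf {k + n, r - n}) by
    convert h using 1
    all_goals simp only [shiftHalf_empty, shiftHalf_pair]
    all_goals push_cast
    all_goals ring_nf
  refine isSqueezing_of_occupation (a := -r - 1 + n) (b := -k - 1 - n) (a' := -r - 1)
    (b' := -k - 1) (by omega) (by omega) (by omega) (by omega) (fun x => ?_) (fun x => ?_)
    (fun x => ?_) (fun x => ?_) fun lam => ?_
  · simp only [Finset.notMem_empty, false_iff]; omega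
  · simp only [Finset.mem_insert, Finset.mem_singleton]; omega
  · simp only [Finset.notMem_empty, false_iff]; omega
  · simp only [Finset.mem_insert, Finset.mem_singleton]; omega
  · simp only [procI, Module.End.mul_apply]
    rcases (hasOccupation_schurState lam).psi (-k - 1) (r := k + 1 / 2)
        (by push_cast; ring) with h | ⟨m1, h⟩
    · left; simp only [h, map_zero]
    rcases h.psi (-r - 1) (r := r + 1 / 2)
        (by push_cast; ring) with h | ⟨m2, h⟩
    · left; simp only [h, map_zero]
    rcases h.psiStar (-r - 1 + n) (r := -(r + 1 / 2) + n)
        (by push_cast; ring) with h | ⟨m3, h⟩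
    · left; simp only [h, map_zero]
    rcases h.psiStar (-k - 1 - n) (r := -(k + 1 / 2) - n)
        (by push_cast; ring) with h | ⟨m4, h⟩
    · left; exact h
    right
    -- The four sites are distinct, so each condition on an intermediate occupation set is a
    -- condition on `maya lam` itself.
    simp only [Set.mem_insert_iff, Set.mem_sdiff, Set.mem_singleton_iff, not_or] at m1 m2 m3 m4
    refine ⟨?_, ?_, ?_, ?_, ?_⟩
    · grind
    · grind
    · grind
    · grind
    · convert h using 1
      ext x
      simp only [Set.mem_insert_iff, Set.mem_sdiff, Set.mem_singleton_iff, not_or, Set.mem_union]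
      grind

theorem isSqueezing_procII {p : ParamN} (hp : p ∈ rangeII) :
    IsSqueezing (procII p) {p.r, p.k} ∅ {p.k - p.n, p.r + p.n} ∅ := by
  obtain ⟨k, r, n⟩ := p
  obtain ⟨⟨k, rfl⟩, ⟨r, rfl⟩, h1, h2, h3, h4⟩ := hp
  simp only at h1 h2 h3 h4
  replace h1 := nonneg_of_half_pos h1
  replace h2 := lt_of_add_half_lt h2
  -- The strict inequality ensures that the two row modes approach each other without meeting.
  replace h4 : 2 * (n : ℤ) < k - r := by
    have h5 := Int.le_floor.1 h4
    push_cast at h5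
    have h6 : ((2 * n : ℤ) : ℚ) < ((k - r : ℤ) : ℚ) := by push_cast; linarith
    exact_mod_cast h6
  suffices h : IsSqueezing (procII ⟨k + 1 / 2, r + 1 / 2, n⟩)
      (shiftHalf {r, k}) (shiftHalf ∅)
      (shiftHalf {k - n, r + n}) (shiftHalf ∅) by
    convert h using 1
    all_goals simp only [shiftHalf_empty, shiftHalf_pair]
    all_goals push_cast
    all_goals ring_nf
  refine isSqueezing_of_occupation (a := k) (b := r) (a' := k - n)
    (b' := r + n) (by omega) (by omega) (by omega) (by omega) (fun x => ?_) (fun x => ?_)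
    (fun x => ?_) (fun x => ?_) fun lam => ?_
  · simp only [Finset.mem_insert, Finset.mem_singleton]; omega
  · simp only [Finset.notMem_empty, false_iff]; omega
  · simp only [Finset.mem_insert, Finset.mem_singleton]; omega
  · simp only [Finset.notMem_empty, false_iff]; omega
  · simp only [procII, Module.End.mul_apply]
    rcases (hasOccupation_schurState lam).psiStar (k) (r := k + 1 / 2)
        (by ring) with h | ⟨m1, h⟩
    · left; simp only [h, map_zero]
    rcases h.psiStar (r) (r := r + 1 / 2)
        (by ring) with h | ⟨m2, h⟩
    · left; simp only [h, map_zero]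
    rcases h.psi (r + n) (r := -(r + 1 / 2) - n)
        (by push_cast; ring) with h | ⟨m3, h⟩
    · left; simp only [h, map_zero]
    rcases h.psi (k - n) (r := -(k + 1 / 2) + n)
        (by push_cast; ring) with h | ⟨m4, h⟩
    · left; exact h
    right
    simp only [Set.mem_insert_iff, Set.mem_sdiff, Set.mem_singleton_iff, not_or] at m1 m2 m3 m4
    refine ⟨?_, ?_, ?_, ?_, ?_⟩
    · grind
    · grind
    · grind
    · grind
    · convert h using 1
      ext x
      simp only [Set.mem_insert_iff, Set.mem_sdiff, Set.mem_singleton_iff, not_or, Set.mem_union]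
      grind

theorem isSqueezing_procIII {p : ParamN} (hp : p ∈ rangeIII) :
    IsSqueezing (procIII p) {p.r} {p.k} {p.r - p.n} {p.k + p.n} := by
  obtain ⟨k, r, n⟩ := p
  obtain ⟨⟨k, rfl⟩, ⟨r, rfl⟩, h1, h2, h3, h4⟩ := hp
  simp only at h1 h2 h3 h4
  replace h1 := nonneg_of_half_pos h1
  replace h2 := nonneg_of_half_pos h2
  replace h4 := natCast_le_of_le_half h4
  suffices h : IsSqueezing (procIII ⟨k + 1 / 2, r + 1 / 2, n⟩)
      (shiftHalf {r}) (shiftHalf {k})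
      (shiftHalf {r - n}) (shiftHalf {k + n}) by
    convert h using 1
    all_goals simp only [shiftHalf_singleton]
    all_goals push_cast
    all_goals ring_nf
  refine isSqueezing_of_occupation (a := r) (b := -k - 1 - n) (a' := r - n)
    (b' := -k - 1) (by omega) (by omega) (by omega) (by omega) (fun x => ?_) (fun x => ?_)
    (fun x => ?_) (fun x => ?_) fun lam => ?_
  · simp only [Finset.mem_singleton]; omega
  · simp only [Finset.mem_singleton]; omega
  · simp only [Finset.mem_singleton]; omega
  · simp only [Finset.mem_singleton]; omega
  · simp only [procIII, Module.End.mul_apply]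
    rcases (hasOccupation_schurState lam).psiStar (r) (r := r + 1 / 2)
        (by ring) with h | ⟨m1, h⟩
    · left; simp only [h, map_zero]
    rcases h.psi (-k - 1) (r := k + 1 / 2)
        (by push_cast; ring) with h | ⟨m2, h⟩
    · left; simp only [h, map_zero]
    rcases h.psiStar (-k - 1 - n) (r := -(k + 1 / 2) - n)
        (by push_cast; ring) with h | ⟨m3, h⟩
    · left; simp only [h, map_zero]
    rcases h.psi (r - n) (r := -(r + 1 / 2) + n)
        (by push_cast; ring) with h | ⟨m4, h⟩
    · left; exact h
    right
    simp only [Set.mem_insert_iff, Set.mem_sdiff, Set.mem_singleton_iff] at m1 m2 m3 m4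
    refine ⟨?_, ?_, ?_, ?_, ?_⟩
    · grind
    · grind
    · grind
    · grind
    · convert h using 1
      ext x
      simp only [Set.mem_insert_iff, Set.mem_sdiff, Set.mem_singleton_iff, not_or, Set.mem_union]
      grind

theorem isSqueezing_procIV {p : ParamS} (hp : p ∈ rangeIV) :
    IsSqueezing (procIV p) {p.s} {p.r, p.k} ∅ {p.r + p.s + p.k} := by
  obtain ⟨k, r, s⟩ := p
  obtain ⟨⟨k, rfl⟩, ⟨r, rfl⟩, ⟨s, rfl⟩, h1, h2, h3⟩ := hp
  simp only at h1 h2 h3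
  replace h1 := nonneg_of_half_pos h1
  replace h2 := lt_of_add_half_lt h2
  replace h3 := nonneg_of_half_pos h3
  -- Three half-integers contribute `3/2`, hence the extra `1` in the integer label of their sum.
  suffices h : IsSqueezing (procIV ⟨k + 1 / 2, r + 1 / 2, s + 1 / 2⟩)
      (shiftHalf {s}) (shiftHalf {r, k})
      (shiftHalf ∅) (shiftHalf {r + s + k + 1}) by
    convert h using 1
    all_goals simp only [shiftHalf_empty, shiftHalf_pair, shiftHalf_singleton]
    all_goals push_cast
    all_goals ring_nf
  refine isSqueezing_of_occupation (a := s) (b := -r - s - k - 2) (a' := -r - 1)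
    (b' := -k - 1) (by omega) (by omega) (by omega) (by omega) (fun x => ?_) (fun x => ?_)
    (fun x => ?_) (fun x => ?_) fun lam => ?_
  · simp only [Finset.mem_singleton]; omega
  · simp only [Finset.mem_insert, Finset.mem_singleton]; omega
  · simp only [Finset.notMem_empty, false_iff]; omega
  · simp only [Finset.mem_singleton]; omega
  · simp only [procIV, Module.End.mul_apply]
    rcases (hasOccupation_schurState lam).psiStar (s) (r := s + 1 / 2)
        (by ring) with h | ⟨m1, h⟩
    · left; simp only [h, map_zero]
    rcases h.psi (-k - 1) (r := k + 1 / 2)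
        (by push_cast; ring) with h | ⟨m2, h⟩
    · left; simp only [h, map_zero]
    rcases h.psi (-r - 1) (r := r + 1 / 2)
        (by push_cast; ring) with h | ⟨m3, h⟩
    · left; simp only [h, map_zero]
    rcases h.psiStar (-r - s - k - 2) (r := -(r + 1 / 2) - (s + 1 / 2) - (k + 1 / 2))
        (by push_cast; ring) with h | ⟨m4, h⟩
    · left; exact h
    right
    simp only [Set.mem_insert_iff, Set.mem_sdiff, Set.mem_singleton_iff, not_or] at m1 m2 m3 m4
    refine ⟨?_, ?_, ?_, ?_, ?_⟩
    · grind
    · grind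
    · grind
    · grind
    · convert h using 1
      ext x
      simp only [Set.mem_insert_iff, Set.mem_sdiff, Set.mem_singleton_iff, not_or, Set.mem_union]
      grind

theorem isSqueezing_procV {p : ParamS} (hp : p ∈ rangeV) :
    IsSqueezing (procV p) {p.r + p.s + p.k} ∅ {p.k, p.r} {p.s} := by
  obtain ⟨k, r, s⟩ := p
  obtain ⟨⟨k, rfl⟩, ⟨r, rfl⟩, ⟨s, rfl⟩, h1, h2, h3⟩ := hp
  simp only at h1 h2 h3
  replace h1 := nonneg_of_half_pos h1
  replace h2 := lt_of_add_half_lt h2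
  replace h3 := nonneg_of_half_pos h3
  suffices h : IsSqueezing (procV ⟨k + 1 / 2, r + 1 / 2, s + 1 / 2⟩)
      (shiftHalf {r + s + k + 1}) (shiftHalf ∅)
      (shiftHalf {k, r}) (shiftHalf {s}) by
    convert h using 1
    all_goals simp only [shiftHalf_empty, shiftHalf_pair, shiftHalf_singleton]
    all_goals push_cast
    all_goals ring_nf
  -- The second particle comes from the occupied negative site `-s - 1`; the hole it leaves is the
  -- new column mode.
  refine isSqueezing_of_occupation (a := r + s + k + 1) (b := -s - 1) (a' := k)
    (b' := r) (by omega) (by omega) (by omega) (by omega) (fun x => ?_) (fun x => ?_)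
    (fun x => ?_) (fun x => ?_) fun lam => ?_
  · simp only [Finset.mem_singleton]; omega
  · simp only [Finset.notMem_empty, false_iff]; omega
  · simp only [Finset.mem_insert, Finset.mem_singleton]; omega
  · simp only [Finset.mem_singleton]; omega
  · simp only [procV, Module.End.mul_apply]
    rcases (hasOccupation_schurState lam).psiStar (r + s + k + 1) (r := (r + 1 / 2) + (s + 1 / 2) + (k + 1 / 2))
        (by push_cast; ring) with h | ⟨m1, h⟩
    · left; simp only [h, map_zero]
    rcases h.psi (r) (r := -(r + 1 / 2))
        (by ring) with h | ⟨m2, h⟩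
    · left; simp only [h, map_zero]
    rcases h.psiStar (-s - 1) (r := -(s + 1 / 2))
        (by push_cast; ring) with h | ⟨m3, h⟩
    · left; simp only [h, map_zero]
    rcases h.psi (k) (r := -(k + 1 / 2))
        (by ring) with h | ⟨m4, h⟩
    · left; exact h
    right
    simp only [Set.mem_insert_iff, Set.mem_sdiff, Set.mem_singleton_iff] at m1 m2 m3 m4
    refine ⟨?_, ?_, ?_, ?_, ?_⟩
    · grind
    · grind
    · grind
    · grind
    · convert h using 1
      ext x
      simp only [Set.mem_insert_iff, Set.mem_sdiff, Set.mem_singleton_iff, not_or, Set.mem_union]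
      grind

/-! ### Triangularity -/

theorem IsSqueezing.apply_mem_lowerSpan {T : Module.End ℂ Fock} {R C R' C' : Finset ℚ}
    (h : IsSqueezing T R C R' C') (lam : YoungDiagram) : T (schurState lam) ∈ lowerSpan lam := by
  rcases h lam with h | ⟨mu, hmu, -, -, -, -, h⟩
  · rw [h]
    exact zero_mem _
  · have hmem : schurState mu ∈ lowerSpan lam := Submodule.subset_span ⟨mu, hmu, rfl⟩
    rcases h with h | h <;> rw [h]
    · exact hmem
    · exact neg_mem hmem

/-- On a fixed vector the sum is finite, so no closure of `W` is involved. -/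
theorem opSum_apply_mem {ι : Type} {S : Set ι} {T : ι → Module.End ℂ Fock} (hT : LocFinite S T)
    {W : Submodule ℂ Fock} {v : Fock} (h : ∀ i ∈ S, T i v ∈ W) : opSum S T v ∈ W := by
  rw [opSum_apply hT]
  exact finsum_mem_induction (· ∈ W) W.zero_mem (fun _ _ => W.add_mem) h

theorem Ht_eq_five_families : Ht = (2 : ℂ) • opSum rangeI termI + (2 : ℂ) • opSum rangeII termII +
    (2 : ℂ) • opSum rangeIII termIII + (2 : ℂ) • opSum rangeIV termIV +
    (2 : ℂ) • opSum rangeV termV := by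
  rw [Ht_eq_redTerm, opSum_redTerm]
  simp only [smul_add]

theorem Ht_schurState_mem_lowerSpan (lam : YoungDiagram) : Ht (schurState lam) ∈ lowerSpan lam := by
  rw [Ht_eq_five_families]
  simp only [LinearMap.add_apply, LinearMap.smul_apply]
  refine add_mem (add_mem (add_mem (add_mem ?_ ?_) ?_) ?_) ?_ <;>
    refine Submodule.smul_mem _ _ ?_
  · exact opSum_apply_mem locFinite_termI fun p hp =>
      Submodule.smul_mem _ _ ((isSqueezing_procI hp).apply_mem_lowerSpan lam)
  · exact opSum_apply_mem locFinite_termII fun p hp =>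
      Submodule.smul_mem _ _ ((isSqueezing_procII hp).apply_mem_lowerSpan lam)
  · exact opSum_apply_mem locFinite_termIII fun p hp =>
      Submodule.smul_mem _ _ ((isSqueezing_procIII hp).apply_mem_lowerSpan lam)
  · exact opSum_apply_mem locFinite_termIV fun p hp =>
      Submodule.smul_mem _ _ ((isSqueezing_procIV hp).apply_mem_lowerSpan lam)
  · exact opSum_apply_mem locFinite_termV fun p hp =>
      Submodule.smul_mem _ _ ((isSqueezing_procV hp).apply_mem_lowerSpan lam)

end CSFermion
theorem mainTheorem4 :
    -- every sum below is locally finite, so it defines an operator on the Fock space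
    (LocFinite HtRange HtTerm ∧ LocFinite redRange redTerm ∧
      LocFinite rangeI termI ∧ LocFinite rangeII termII ∧ LocFinite rangeIII termIII ∧
      LocFinite rangeIV termIV ∧ LocFinite rangeV termV) ∧
    -- the reduction to the region `k + l > 0`, `k + s < 0`, `k > r`, `r + s + k + l = 0`
    Ht = (2 : ℂ) • opSum redRange redTerm ∧
    -- the decomposition into five families
    Ht = (2 : ℂ) • opSum rangeI termI + (2 : ℂ) • opSum rangeII termII +
      (2 : ℂ) • opSum rangeIII termIII + (2 : ℂ) • opSum rangeIV termIV +
      (2 : ℂ) • opSum rangeV termV ∧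
    -- the action of the five processes on Schur states
    (∀ p ∈ rangeI, IsSqueezing (procI p) ∅ {p.r, p.k} ∅ {p.k + p.n, p.r - p.n}) ∧
    (∀ p ∈ rangeII, IsSqueezing (procII p) {p.r, p.k} ∅ {p.k - p.n, p.r + p.n} ∅) ∧
    (∀ p ∈ rangeIII, IsSqueezing (procIII p) {p.r} {p.k} {p.r - p.n} {p.k + p.n}) ∧
    (∀ p ∈ rangeIV, IsSqueezing (procIV p) {p.s} {p.r, p.k} ∅ {p.r + p.s + p.k}) ∧
    (∀ p ∈ rangeV, IsSqueezing (procV p) {p.r + p.s + p.k} ∅ {p.k, p.r} {p.s}) ∧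
    -- triangularity
    (∀ lam : YoungDiagram, Ht (schurState lam) ∈ lowerSpan lam) := by
  exact ⟨⟨locFinite_HtTerm, locFinite_redTerm, locFinite_termI, locFinite_termII, locFinite_termIII,
    locFinite_termIV, locFinite_termV⟩, Ht_eq_redTerm, Ht_eq_five_families,
    fun _ => isSqueezing_procI, fun _ => isSqueezing_procII, fun _ => isSqueezing_procIII,
    fun _ => isSqueezing_procIV, fun _ => isSqueezing_procV, Ht_schurState_mem_lowerSpan⟩
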